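/- For a set $F$ of finitary operations on a set $A$, let $\operatorname{Inv}(F)$ be the set of all finitary relations on $A$ preserved by every operation in $F$; for an algebra, $\operatorname{Inv}$ refers to its basic operations. For a relational structure $\mathfrak A$, let $\operatorname{Pol}(\mathfrak A)$ be the set of all operations of arity at least $1$ that preserve every relation of $\mathfrak A$. Let $n\ge 2$ and write $0^j$ for the sequence of $j$ zeros, $\epsilon=0^0$. **The algebras $\mathbf P^{n,k}$.** Let $\mathcal P_{n,0}$ be the tree with the single vertex $\epsilon$. Let $\mathcal P_{n,1}$ be the tree with root $\epsilon$ and leaves $(0),\dots,(n-1)$; its root carries the ternary minority operation $p_n$ on $\{0,\dots,n-1\}$ that returns its second argument on triples of pairwise distinct entries (minority means $p(x,x,y)=p(x,y,x)=p(y,x,x)=y$). Let $\mathcal P_{n,k+1}$ arise from $\mathcal P_{n,k}$ by attaching a copy of $\mathcal P_{n,1}$ at the leaf $0^k$, i.e. by replacing $0^k$ with all concatenations $0^k{}^\frown w$, $w\in\mathcal P_{n,1}$. Vertices are finite sequences, and $w$ lies below $v$ if $v$ is an initial segment of $w$. The domain $P^{n,k}$ of $\mathbf P^{n,k}$ is the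 set of leaves of $\mathcal P_{n,k}$, i.e. $0^k$ and all $(0^j,c)$ with $0\le j<k$, $1\le c\le n-1$. Its only basic operation is the ternary operation $m$ with $m(a,a,a)=a$ and, if $a,b,c$ are not all equal and $d$ is their longest common initial segment, $m(a,b,c)$ is the unique $x\in\{a,b,c\}$ whose entry following $d$ is $p_n(a',b',c')$, where $a',b',c'$ are the entries following $d$ in $a,b,c$. **The structures $\mathfrak P^{n,k}$.** Let $O_n=\{(1),\dots,(n-1)\}$. For $0\le i\le k$ let $\psi_i\colon P^{n,k}\to P^{n,k+1}$ map $0^k$ to $0^{k+1}$ and, for $1\le c\le n-1$, map $(0^j,c)$ to $(0^j,c)$ if $j<i$ and to $(0^{j+1},c)$ if $j\ge i$. For relations $S$ on $P^{n,k}$ and $Y$ on $O_n$ of the same arity, let $S\oplus Y=\psi_0(S)\cup Y$, a relation on $P^{n,k+1}$. The structure $\mathfrak P^{n,0}$ has domain $P^{n,0}=\{\epsilon\}$ and as relations the unary relations $\emptyset$ and $\{\epsilon\}$ and the binary and the ternary equality relation. The structure $\mathfrak P^{n,k+1}$ has domain $P^{n,k+1}$ and the following relations: 1. all $S\oplus Y$,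 where $S$ is a relation of $\mathfrak P^{n,k}$ and $Y$, of the same arity, is a subset of $O_n$, the graph of a permutation of $O_n$, or the ternary equality relation on $O_n$; 2. the full binary relation on $P^{n,k+1}$; 3. the canonical transfer relation $\{(\psi_0(a),\psi_k(a)) : a\in P^{n,k}\}$; 4. only if $k+1=1$: the graph of the permutation of $P^{n,1}$ that switches $(0)$ and $(1)$ and fixes all other elements, and the ternary relation $\{((1),(1),(1)),((1),(0),(0)),((0),(1),(0)),((0),(0),(1))\}$. **Statement.** For all $n\ge 2$ and $k\ge 0$, $$\operatorname{Inv}(\mathbf P^{n,k})=\operatorname{Inv}(\operatorname{Pol}(\mathfrak P^{n,k})),$$ and this is the set of all relations with a primitive positive definition in $\mathfrak P^{n,k}$, i.e. a definition $\exists y_1\cdots y_m(\psi_1\wedge\dots\wedge\psi_r)$ in which each $\psi_i$ is an atomic formula (equality atoms included). -/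

import Mathlib

namespace ProjTree

/-! ### Operations, relations, invariants -/

/-- A relation of some finite arity on `A`. -/
abbrev Rel (A : Type) : Type := Σ l : ℕ, Set (Fin l → A)

/-- An operation of some finite arity on `A`. -/
abbrev Op (A : Type) : Type := Σ m : ℕ, ((Fin m → A) → A)

/-- The operation `f` preserves the relation `R`: applying `f` coordinatewise to tuples of `R`
gives a tuple of `R`. -/
def Preserves {A : Type} (f : Op A) (R : Rel A) : Prop :=
  ∀ t : Fin f.1 → Fin R.1 → A, (∀ i, t i ∈ R.2) → (fun j => f.2 (fun i => t i j)) ∈ R.2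

/-- `Inv F`: all relations that are preserved by all operations in `F`. -/
def Inv {A : Type} (F : Set (Op A)) : Set (Rel A) :=
  {R | ∀ f ∈ F, Preserves f R}

/-- The basic relation named by the relation symbol `ρ`. -/
def basicRel (L : FirstOrder.Language.{0, 0}) (A : Type) [L.Structure A] {l : ℕ} (ρ : L.Relations l) :
    Rel A :=
  ⟨l, {t | FirstOrder.Language.Structure.RelMap ρ t}⟩

/-- The polymorphisms of a relational structure: the operations of positive arity that preserve
all its basic relations. -/
def Pol (L : FirstOrder.Language.{0, 0}) (A : Type) [L.Structure A] : Set (Op A) :=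
  {f | 1 ≤ f.1 ∧ ∀ (l : ℕ) (ρ : L.Relations l), Preserves f (basicRel L A ρ)}

/-- The relations that have a primitive positive definition
`∃ y₁ … yₘ (ψ₁ ∧ ⋯ ∧ ψᵣ)` with atomic `ψ₁, …, ψᵣ`. -/
def PPDef (L : FirstOrder.Language.{0, 0}) (A : Type) [L.Structure A] : Set (Rel A) :=
  {R | ∃ (m : ℕ) (Ψ : List (L.Formula (Fin R.1 ⊕ Fin m))),
    (∀ ψ ∈ Ψ, FirstOrder.Language.BoundedFormula.IsAtomic ψ) ∧
    ∀ t : Fin R.1 → A, t ∈ R.2 ↔ ∃ y : Fin m → A, ∀ ψ ∈ Ψ, ψ.Realize (Sum.elim t y)}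

/-! ### Branch trees and their leaf algebras -/

/-- The data of a finite branch tree over `ℕ`: a finite set of vertices, which are finite
sequences, and for every vertex `v` a ternary operation on the set `{a | v ++ [a] ∈ verts}` of
children of `v` (its values elsewhere play no role). A vertex `w` lies below `v` when `v` is an
initial segment of `w`. -/
structure BranchTree where
  verts : Finset (List ℕ)
  localOp : List ℕ → ℕ → ℕ → ℕ → ℕ

/-- The leaves: vertices with no vertex strictly below. -/
def BranchTree.leaves (T : BranchTree) : Finset (List ℕ) :=
  T.verts.filter fun v => ∀ w ∈ T.verts, v <+: w → w = v

/-- The domain of the leaf algebra. -/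
abbrev BranchTree.Leaf (T : BranchTree) : Type := {v : List ℕ // v ∈ T.leaves}

/-- The longest common initial segment of two sequences, i.e. their join in the tree order. -/
def lcp : List ℕ → List ℕ → List ℕ
  | a :: v, b :: w => if a = b then a :: lcp v w else []
  | _, _ => []

/-- The entry of `v` that follows the proper initial segment `d` of `v`, i.e. the child of `d`
on the branch from the root to `v`. -/
def childOn (d v : List ℕ) : ℕ := v.getD d.length 0

/-- The operation of the leaf algebra: it is idempotent, and if `a, b, c` are not all equal and
`d` is their join, then it returns the one among `a, b, c` that lies below the child of `d` which
the local operation at `d` selects. -/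
def BranchTree.leafOp (T : BranchTree) (a b c : T.Leaf) : T.Leaf :=
  if a = b ∧ b = c then a
  else
    let d := lcp a.1 (lcp b.1 c.1)
    let x := T.localOp d (childOn d a.1) (childOn d b.1) (childOn d c.1)
    if x = childOn d a.1 then a
    else if x = childOn d b.1 then b
    else c

/-- The set of basic operations of the leaf algebra; it has one element. -/
def BranchTree.basicOps (T : BranchTree) : Set (Op T.Leaf) :=
  {⟨3, fun x => T.leafOp (x 0) (x 1) (x 2)⟩}

/-- Attaching the root of `S` to the leaf `v` of `T`. -/
def BranchTree.graft (T : BranchTree) (v : List ℕ) (S : BranchTree) : BranchTree where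
  verts := T.verts.erase v ∪ S.verts.image (v ++ ·)
  localOp w := if v <+: w then S.localOp (w.drop v.length) else T.localOp w

/-! ### The algebras `P^{n,k}` -/

/-- The minority operation that returns the second argument on injective triples. -/
def projMinority (a b c : ℕ) : ℕ :=
  if a = b then c else if a = c then b else if b = c then a else b

/-- The tree with the single vertex `ε`. -/
def pointTree : BranchTree where
  verts := {[]}
  localOp _ := projMinority

/-- The height one tree with leaves `(0), …, (n-1)` and the projection minority operation at the
root. -/
def starTree (n : ℕ) : BranchTree where
  verts := insert [] ((Finset.range n).image fun i => [i])
  localOp _ := projMinority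

/-- The trees `𝒫_{n,k}`. -/
def projTree (n : ℕ) : ℕ → BranchTree
  | 0 => pointTree
  | k + 1 => (projTree n k).graft (List.replicate k 0) (starTree n)

/-- The domain of the algebra `P^{n,k}`. -/
abbrev P (n k : ℕ) : Type := (projTree n k).Leaf

/-! ### The structures `𝔓^{n,k}` -/

/-- The set `O_n = {(1), …, (n-1)}`. -/
abbrev O (n : ℕ) : Type := {v : List ℕ // ∃ c, 0 < c ∧ c < n ∧ v = [c]}

/-- The relation symbols of the structure on `O_n`, by arity. -/
inductive OSym (n : ℕ) : ℕ → Type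
  | unary (Y : Set (O n)) : OSym n 1
  | graph (σ : Equiv.Perm (O n)) : OSym n 2
  | eq3 : OSym n 3

/-- The relations of the structure on `O_n`. -/
def OSym.interp {n : ℕ} : {l : ℕ} → OSym n l → Set (Fin l → O n)
  | _, .unary Y => {t | t 0 ∈ Y}
  | _, .graph σ => {t | t 1 = σ (t 0)}
  | _, .eq3 => {t | t 0 = t 1 ∧ t 1 = t 2}

/-- The canonical embedding `ψ_i` of `P^{n,k}` into `P^{n,k+1}`, for `0 ≤ i ≤ k`, on sequences:
`0^k ↦ 0^{k+1}`, and a leaf `(0^j, c)` with `0 < c` goes to `(0^j, c)` if `j < i` and to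
`(0^{j+1}, c)` if `i ≤ j`. -/
def psi (k i : ℕ) (v : List ℕ) : List ℕ :=
  if v = List.replicate k 0 then List.replicate (k + 1) 0
  else if i < v.length then 0 :: v
  else v

/-- `S ⊕ Y = ψ_0(S) ∪ Y`. -/
def oplus {n k l : ℕ} (S : Set (Fin l → P n k)) (Y : Set (Fin l → O n)) :
    Set (Fin l → P n (k + 1)) :=
  {t | (∃ s ∈ S, ∀ i, (t i).1 = psi k 0 (s i).1) ∨ ∃ y ∈ Y, ∀ i, (t i).1 = (y i).1}

/-- The isomorphism graph `T^{n,k+1}_{i,j}` between the images of `ψ_i` and `ψ_j`. -/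
def transferRel (n k i j : ℕ) : Set (Fin 2 → P n (k + 1)) :=
  {t | ∃ a : P n k, (t 0).1 = psi k i a.1 ∧ (t 1).1 = psi k j a.1}

/-- The relation symbols of `τ_{n,k}`: `PSym n k l` is the set of those of arity `l`. -/
inductive PSym (n : ℕ) : ℕ → ℕ → Type
  | empty : PSym n 0 1
  | single : PSym n 0 1
  | eq2 : PSym n 0 2
  | eq3 : PSym n 0 3
  | pair {k l : ℕ} (ρ₁ : PSym n k l) (ρ₂ : OSym n l) : PSym n (k + 1) l
  | full {k : ℕ} : PSym n (k + 1) 2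
  | transfer {k : ℕ} : PSym n (k + 1) 2
  | swap : PSym n 1 2
  | lin : PSym n 1 3

/-- The relations of the structure `𝔓^{n,k}`. -/
def PSym.interp {n : ℕ} : {k l : ℕ} → PSym n k l → Set (Fin l → P n k)
  | _, _, .empty => ∅
  | _, _, .single => {t | (t 0).1 = []}
  | _, _, .eq2 => {t | t 0 = t 1}
  | _, _, .eq3 => {t | t 0 = t 1 ∧ t 1 = t 2}
  | _, _, .pair ρ₁ ρ₂ => oplus ρ₁.interp ρ₂.interp
  | _, _, .full => Set.univ
  | _, _, .transfer (k := k) => transferRel n k 0 k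
  | _, _, .swap => {t | (t 1).1 = Equiv.swap [0] [1] (t 0).1}
  | _, _, .lin => {t | (fun i => (t i).1) ∈
      ({![[1], [1], [1] ], ![[1], [0], [0] ], ![[0], [1], [0] ], ![[0], [0], [1] ]} :
        Set (Fin 3 → List ℕ))}

/-- The relational signature `τ_{n,k}`. -/
def sig (n k : ℕ) : FirstOrder.Language.{0, 0} where
  Functions _ := Empty
  Relations := PSym n k

/-- The relational structure `𝔓^{n,k}` with domain `P^{n,k}`. -/
instance structP (n k : ℕ) : (sig n k).Structure (P n k) where
  funMap f := f.elim
  RelMap ρ t := t ∈ PSym.interp ρ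

end ProjTree

open FirstOrder

/-! Polymorphisms respect primitive positive definitions, and the basic operation is itself a
polymorphism (`basicOps_subset_pol`), so the content is that every relation R closed under the basic
operation is definable (`OpClosed.ppd`).

The tree matters only through the level of a leaf: by `leafOp_eq_op` the operation is a minority
which, on three distinct leaves, returns the one of strictly least level if it exists and the second
argument otherwise. As everything is finite, it suffices to separate each t ∉ R from R by a
definable superset of R (`exists_separating`). After projecting coordinates away, t enters R
whenever a single coordinate i is changed to a suitable s i. At coordinate i, all levels deeper than
both or one of t i, s i, that is, beyond the minimum of their levels, can be collapsed to one leaf: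
this is a definable endomorphism, and t stays excluded (`ret_ne_of_notMem`).

The resulting `Critical` relations are rigid, because two tuples that agree off h and take the
values t h and s h there would generate t (`Critical.false_of_eq`). Call a value at i shallow if its
level is less than the minimum for i, and deep otherwise. A tuple is shallow everywhere or nowhere,
and the coordinates of shallow tuples determine each other and the order of levels. In arity 2 the
relation is the graph of a partial bijection; in arity at least 3 the deep tuples are exactly the
choices from the pairs s i, t i with an odd number of s i.

Hence two kinds of relations must be defined. Parity relations are running sums built from the
symbols `lin` and `swap`. Partial bijections that respect strictly least elements of triples
(`pp2_of_biunique`) are treated by pushing both sides as deep as possible with definable injections;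
then the levels agree, up to a transposition at the bottom, and a level-preserving partial bijection
extends to a basic relation made from permutations of O_n. -/

namespace ProjTree

/-! ### Calculus of primitive positive definitions. -/

section PrimitivePositive

/-! ### Primitive positive definability over arbitrary index types -/

/-- The solution set of a single atomic constraint on the variables `X`. -/
def IsAtomSet (n k : ℕ) {X : Type} (T : Set (X → P n k)) : Prop :=
  (∃ x y : X, T = {t | t x = t y}) ∨
    ∃ (l : ℕ) (ρ : PSym n k l) (g : Fin l → X), T = {t | t ∘ g ∈ ρ.interp}

/-- Primitive positive definability of a set of assignments of an arbitrary type of variables. -/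
def PPd {n k : ℕ} {V : Type} (S : Set (V → P n k)) : Prop :=
  ∃ (W : Type) (_ : Finite W) (F : Set (Set (V ⊕ W → P n k))),
    (∀ T ∈ F, IsAtomSet n k T) ∧ ∀ t, t ∈ S ↔ ∃ y : W → P n k, ∀ T ∈ F, Sum.elim t y ∈ T

variable {n k : ℕ} {V : Type}

theorem IsAtomSet.comap {X Y : Type} {T : Set (X → P n k)} (hT : IsAtomSet n k T) (g : X → Y) :
    IsAtomSet n k {t : Y → P n k | t ∘ g ∈ T} := by
  rcases hT with ⟨x, y, rfl⟩ | ⟨l, ρ, f, rfl⟩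
  · exact Or.inl ⟨g x, g y, rfl⟩
  · exact Or.inr ⟨l, ρ, g ∘ f, rfl⟩

theorem PPd.congr {S S' : Set (V → P n k)} (h : PPd S) (e : ∀ t, t ∈ S' ↔ t ∈ S) : PPd S' := by
  rwa [show S' = S from Set.ext e]

theorem IsAtomSet.ppd {T : Set (V → P n k)} (hT : IsAtomSet n k T) : PPd T := by
  refine ⟨Empty, inferInstance, {{t | t ∘ Sum.inl ∈ T}}, ?_, fun t => ?_⟩
  · rintro _ rfl
    exact hT.comap _
  · constructor
    · rintro h
      refine ⟨Empty.elim, ?_⟩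
      rintro _ rfl
      simpa using h
    · rintro ⟨y, hy⟩
      simpa using hy _ rfl

theorem PPd.sym {l : ℕ} (ρ : PSym n k l) : PPd ρ.interp :=
  IsAtomSet.ppd (Or.inr ⟨l, ρ, id, rfl⟩)

theorem PPd.eq (x y : V) : PPd {t : V → P n k | t x = t y} :=
  IsAtomSet.ppd (Or.inl ⟨x, y, rfl⟩)

theorem PPd.comap {V' : Type} {S : Set (V → P n k)} (hS : PPd S) (g : V → V') :
    PPd {t : V' → P n k | t ∘ g ∈ S} := by
  obtain ⟨W, hW, F, hF, hS⟩ := hS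
  refine ⟨W, hW, (fun T => {t | t ∘ Sum.map g id ∈ T}) '' F, ?_, fun t => ?_⟩
  · rintro _ ⟨T, hT, rfl⟩
    exact (hF T hT).comap _
  · simp only [Set.mem_ofPred_eq, hS, Set.forall_mem_image]
    refine exists_congr fun y => forall₂_congr fun T hT => ?_
    rw [Sum.elim_comp_map, Function.comp_id]

theorem PPd.forall {ι : Type} [Finite ι] {S : ι → Set (V → P n k)} (hS : ∀ i, PPd (S i)) :
    PPd {t | ∀ i, t ∈ S i} := by
  choose W hW F hF hS using hS
  refine ⟨Σ i, W i, inferInstance,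
    {T' | ∃ i, ∃ T ∈ F i, T' = {t | t ∘ Sum.map id (Sigma.mk i) ∈ T}}, ?_, fun t => ?_⟩
  · rintro _ ⟨i, T, hT, rfl⟩
    exact (hF i T hT).comap _
  · simp only [Set.mem_ofPred_eq, hS]
    constructor
    · intro h
      choose y hy using h
      refine ⟨fun p => y p.1 p.2, ?_⟩
      rintro _ ⟨i, T, hT, rfl⟩
      have := hy i T hT
      rw [Set.mem_ofPred_eq, Sum.elim_comp_map]
      exact this
    · rintro ⟨y, hy⟩ i
      refine ⟨fun w => y ⟨i, w⟩, fun T hT => ?_⟩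
      have := hy _ ⟨i, T, hT, rfl⟩
      rw [Set.mem_ofPred_eq, Sum.elim_comp_map] at this
      exact this

theorem PPd.and {S S' : Set (V → P n k)} (h : PPd S) (h' : PPd S') :
    PPd {t | t ∈ S ∧ t ∈ S'} := by
  refine (PPd.forall (S := fun b : Bool => cond b S S') ?_).congr fun t => ?_
  · rintro (_ | _)
    exacts [h', h]
  · simp [and_comm]

theorem PPd.exists {U : Type} [Finite U] {S : Set (V ⊕ U → P n k)} (hS : PPd S) :
    PPd {t | ∃ u, Sum.elim t u ∈ S} := by
  obtain ⟨W, hW, F, hF, hS⟩ := hS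
  refine ⟨U ⊕ W, inferInstance, (fun T => {t | t ∘ Equiv.sumAssoc V U W ∈ T}) '' F, ?_,
    fun t => ?_⟩
  · rintro _ ⟨T, hT, rfl⟩
    exact (hF T hT).comap _
  · have key : ∀ (u : U → P n k) (y : W → P n k),
        Sum.elim t (Sum.elim u y) ∘ Equiv.sumAssoc V U W = Sum.elim (Sum.elim t u) y := by
      intro u y
      ext ((v | v) | v) <;> rfl
    simp only [Set.mem_ofPred_eq, hS, Set.forall_mem_image]
    constructor
    · rintro ⟨u, y, h⟩
      exact ⟨Sum.elim u y, fun T hT => by rw [key]; exact h T hT⟩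
    · rintro ⟨z, h⟩
      refine ⟨z ∘ Sum.inl, z ∘ Sum.inr, fun T hT => ?_⟩
      rw [← key, Sum.elim_comp_inl_inr]
      exact h hT

theorem PPd.exists_one {S : Set (Option V → P n k)} (hS : PPd S) :
    PPd {t : V → P n k | ∃ u, (fun o : Option V => o.elim u t) ∈ S} := by
  refine ((hS.comap (fun o : Option V => o.elim (Sum.inr ()) Sum.inl)).exists
    (U := Unit)).congr fun t => ?_
  have key : ∀ u : Unit → P n k,
      Sum.elim t u ∘ (fun o : Option V => o.elim (Sum.inr ()) Sum.inl) =
        fun o : Option V => o.elim (u ()) t := by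
    intro u
    ext (_ | o) <;> rfl
  simp only [Set.mem_ofPred_eq, key]
  exact ⟨fun ⟨u, h⟩ => ⟨fun _ => u, h⟩, fun ⟨u, h⟩ => ⟨u (), h⟩⟩

/-- Definability of a unary predicate. -/
def PP1 (n k : ℕ) (E : P n k → Prop) : Prop := PPd {t : Fin 1 → P n k | E (t 0)}

/-- Definability of a binary predicate. -/
def PP2 (n k : ℕ) (E : P n k → P n k → Prop) : Prop := PPd {t : Fin 2 → P n k | E (t 0) (t 1)}

/-- Definability of a ternary predicate. -/
def PP3 (n k : ℕ) (E : P n k → P n k → P n k → Prop) : Prop :=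
  PPd {t : Fin 3 → P n k | E (t 0) (t 1) (t 2)}

theorem PP1.app {E : P n k → Prop} (h : PP1 n k E) (a : V) : PPd {t : V → P n k | E (t a)} :=
  PPd.comap h ![a]

theorem PP2.app {E : P n k → P n k → Prop} (h : PP2 n k E) (a b : V) :
    PPd {t : V → P n k | E (t a) (t b)} :=
  PPd.comap h ![a, b]

theorem PP3.app {E : P n k → P n k → P n k → Prop} (h : PP3 n k E) (a b c : V) :
    PPd {t : V → P n k | E (t a) (t b) (t c)} :=
  PPd.comap h ![a, b, c]

theorem PP2.congr {E E' : P n k → P n k → Prop} (h : PP2 n k E) (e : ∀ x y, E' x y ↔ E x y) :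
    PP2 n k E' :=
  PPd.congr h fun _ => e _ _

theorem PP2.symm {E : P n k → P n k → Prop} (h : PP2 n k E) : PP2 n k fun x y => E y x :=
  h.app 1 0

theorem PP2.comp {E F : P n k → P n k → Prop} (h : PP2 n k E) (h' : PP2 n k F) :
    PP2 n k fun x y => ∃ z, E x z ∧ F z y :=
  PPd.exists_one ((h.app (some 0) none).and (h'.app none (some 1)))

theorem PP2.eq : PP2 n k fun x y => x = y := PPd.eq 0 1

theorem PP2.and_left {E : P n k → P n k → Prop} {F : P n k → Prop} (h : PP2 n k E)
    (h' : PP1 n k F) : PP2 n k fun x y => E x y ∧ F x :=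
  PPd.and h (h'.app 0)

theorem PP2.and_right {E : P n k → P n k → Prop} {F : P n k → Prop} (h : PP2 n k E)
    (h' : PP1 n k F) : PP2 n k fun x y => E x y ∧ F y :=
  PPd.and h (h'.app 1)

theorem IsAtomSet.exists_formula {X : Type} {T : Set (X → P n k)} (hT : IsAtomSet n k T) :
    ∃ ψ : (sig n k).Formula X, Language.BoundedFormula.IsAtomic ψ ∧
      ∀ t, ψ.Realize t ↔ t ∈ T := by
  rcases hT with ⟨x, y, rfl⟩ | ⟨l, ρ, g, rfl⟩
  · refine ⟨Language.Term.equal (Language.var x) (Language.var y),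
      Language.BoundedFormula.IsAtomic.equal _ _, fun t => ?_⟩
    rw [Language.Formula.realize_equal]
    simp
  · refine ⟨Language.Relations.formula (L := sig n k) (show (sig n k).Relations l from ρ)
      fun i => Language.var (g i), Language.BoundedFormula.IsAtomic.rel _ _, fun t => ?_⟩
    rw [Language.Formula.realize_rel]
    rfl

theorem PPd.mem_ppDef {l : ℕ} {S : Set (Fin l → P n k)} (h : PPd S) :
    (⟨l, S⟩ : Rel (P n k)) ∈ PPDef (sig n k) (P n k) := by
  obtain ⟨W, hW, F, hF, hS⟩ := h
  obtain ⟨m, ⟨e⟩⟩ := Finite.exists_equiv_fin W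
  have hF' := fun T : F => ((hF T.1 T.2).comap (Sum.map id e)).exists_formula
  choose ψ hψ hψ' using hF'
  have : Finite F := Set.toFinite F
  cases nonempty_fintype F
  refine ⟨m, (Finset.univ : Finset F).toList.map ψ, ?_, fun t => ?_⟩
  · simp only [List.mem_map]
    rintro _ ⟨T, -, rfl⟩
    exact hψ T
  · have key : ∀ y : Fin m → P n k,
        (∀ φ ∈ (Finset.univ : Finset F).toList.map ψ, φ.Realize (Sum.elim t y)) ↔
          ∀ T ∈ F, Sum.elim t (y ∘ e) ∈ T := by
      intro y
      simp only [List.mem_map, Finset.mem_toList, Finset.mem_univ, true_and]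
      constructor
      · intro h T hT
        simpa [hψ', Sum.elim_comp_map] using h _ ⟨⟨T, hT⟩, rfl⟩
      · rintro h _ ⟨T, rfl⟩
        simpa [hψ', Sum.elim_comp_map] using h T.1 T.2
    refine (hS t).trans ⟨fun ⟨y, h⟩ => ⟨y ∘ e.symm, (key _).2 ?_⟩,
      fun ⟨y, h⟩ => ⟨y ∘ e, (key y).1 h⟩⟩
    simpa [Function.comp_assoc] using h

/-! ### Primitive positive definable relations are invariant under polymorphisms -/

theorem Preserves.of_isAtomic {f : Op (P n k)} (hf : f ∈ Pol (sig n k) (P n k)) {X : Type}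
    {ψ : (sig n k).Formula X} (hψ : Language.BoundedFormula.IsAtomic ψ)
    (t : Fin f.1 → X → P n k) (ht : ∀ i, ψ.Realize (t i)) :
    ψ.Realize fun x => f.2 fun i => t i x := by
  -- The signature has no function symbols, so every term is a variable.
  have term : ∀ (τ : (sig n k).Term (X ⊕ Fin 0)), ∃ x, τ = Language.var (Sum.inl x) := by
    rintro ((x | x) | ⟨g, _⟩)
    · exact ⟨x, rfl⟩
    · exact x.elim0
    · exact Empty.elim g
  cases hψ with
  | equal t₁ t₂ =>
    obtain ⟨x, rfl⟩ := term t₁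
    obtain ⟨y, rfl⟩ := term t₂
    simp only [Language.Formula.Realize, Language.BoundedFormula.realize_bdEqual,
      Language.Term.realize_var, Sum.elim_inl] at ht ⊢
    simp [ht]
  | @rel l ρ ts =>
    choose g hg using fun i => term (ts i)
    obtain rfl : ts = fun i => Language.var (Sum.inl (g i)) := funext hg
    simp only [Language.Formula.Realize, Language.BoundedFormula.realize_rel,
      Language.Term.realize_var, Sum.elim_inl] at ht ⊢
    exact hf.2 l ρ (fun i j => t i (g j)) ht

theorem ppDef_subset_inv_pol :
    PPDef (sig n k) (P n k) ⊆ Inv (Pol (sig n k) (P n k)) := by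
  rintro R ⟨m, Ψ, hΨ, hR⟩ f hf t ht
  simp only [hR] at ht ⊢
  choose y hy using ht
  refine ⟨fun x => f.2 fun i => y i x, fun ψ hψ => ?_⟩
  convert Preserves.of_isAtomic hf (hΨ ψ hψ) (fun i => Sum.elim (t i) (y i))
    (fun i => hy i ψ hψ) using 1
  ext (x | x) <;> rfl

end PrimitivePositive

/-! ### The leaf algebra as a minority operation governed by levels. -/

section LeafAlgebra

/-! ### The conservative minority operation of a level function -/

/-- The minority operation that, on three distinct elements, returns the one of strictly least
level if there is one, and its second argument otherwise. -/
def op {A : Type} [DecidableEq A] (lev : A → ℕ) (a b c : A) : A :=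
  if a = b then c else if a = c then b else if b = c then a
  else if lev a < lev b ∧ lev a < lev c then a
  else if lev c < lev a ∧ lev c < lev b then c
  else b

/-- Closure of a set of tuples under the coordinatewise operation `op lev`. -/
def OpClosed {A V : Type} [DecidableEq A] (lev : A → ℕ) (R : Set (V → A)) : Prop :=
  ∀ x ∈ R, ∀ y ∈ R, ∀ z ∈ R, (fun i => op lev (x i) (y i) (z i)) ∈ R

section Op

variable {A B : Type} [DecidableEq A] [DecidableEq B] {lev : A → ℕ} {lev' : B → ℕ}

@[simp] theorem op_left (a c : A) : op lev a a c = c := by simp [op]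

@[simp] theorem op_mid (a b : A) : op lev a b a = b := by
  unfold op; split_ifs <;> simp_all

@[simp] theorem op_right (a b : A) : op lev a b b = a := by
  unfold op; split_ifs <;> simp_all

/-- The operation commutes with correspondences that preserve equality and strict minima. -/
theorem op_cases {a b c : A} {a' b' c' : B} (hab : a = b ↔ a' = b') (hac : a = c ↔ a' = c')
    (hbc : b = c ↔ b' = c')
    (ha : a ≠ b → a ≠ c → b ≠ c →
      (lev a < lev b ∧ lev a < lev c ↔ lev' a' < lev' b' ∧ lev' a' < lev' c'))
    (hc : a ≠ b → a ≠ c → b ≠ c →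
      (lev c < lev a ∧ lev c < lev b ↔ lev' c' < lev' a' ∧ lev' c' < lev' b')) :
    (op lev a b c = a ∧ op lev' a' b' c' = a') ∨ (op lev a b c = b ∧ op lev' a' b' c' = b') ∨
      (op lev a b c = c ∧ op lev' a' b' c' = c') := by
  unfold op
  split_ifs <;> simp_all

theorem op_map {f : A → B} (hf : Function.Injective f)
    (hlev : ∀ x y, lev x < lev y ↔ lev' (f x) < lev' (f y)) (a b c : A) :
    op lev' (f a) (f b) (f c) = f (op lev a b c) := by
  unfold op
  simp only [hf.eq_iff, ← hlev]
  split_ifs <;> rfl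

end Op

/-! ### The leaves of `𝒫_{n,k}` -/

/-- The number of zeros at the beginning of a sequence. -/
def leadZeros : List ℕ → ℕ
  | 0 :: v => leadZeros v + 1
  | _ => 0

variable {n k : ℕ}

/-- The level of a leaf: the number of its leading zeros. -/
def lev (v : P n k) : ℕ := leadZeros v.1

/-- The last entry of a leaf, which is `0` only at the leaf `0^k`. -/
def col (v : P n k) : ℕ := v.1.sum

theorem mem_verts (hn : 2 ≤ n) (w : List ℕ) :
    w ∈ (projTree n k).verts ↔ (∃ j ≤ k, w = List.replicate j 0) ∨
      ∃ j < k, ∃ c, 0 < c ∧ c < n ∧ w = List.replicate j 0 ++ [c] := by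
  induction k with
  | zero => simp [projTree, pointTree]
  | succ k ih =>
    have : w ∈ (projTree n (k + 1)).verts ↔ w ∈ (projTree n k).verts ∨
        w = List.replicate k 0 ∨ ∃ c < n, w = List.replicate k 0 ++ [c] := by
      simp only [projTree, BranchTree.graft, starTree, Finset.mem_union, Finset.mem_erase,
        Finset.mem_image, Finset.mem_insert, Finset.mem_range]
      constructor
      · rintro (⟨-, h⟩ | ⟨a, rfl | ⟨c, hc, rfl⟩, rfl⟩)
        · exact Or.inl h
        · simp
        · exact Or.inr (Or.inr ⟨c, hc, rfl⟩)
      · rintro (h | rfl | ⟨c, hc, rfl⟩)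
        · by_cases hw : w = List.replicate k 0
          · exact Or.inr ⟨[], Or.inl rfl, by simp [hw]⟩
          · exact Or.inl ⟨hw, h⟩
        · exact Or.inr ⟨[], Or.inl rfl, by simp⟩
        · exact Or.inr ⟨[c], Or.inr ⟨c, hc, rfl⟩, rfl⟩
    rw [this, ih]
    constructor
    · rintro ((⟨j, hj, rfl⟩ | ⟨j, hj, c, h0, hc, rfl⟩) | rfl | ⟨c, hc, rfl⟩)
      · exact Or.inl ⟨j, by omega, rfl⟩
      · exact Or.inr ⟨j, by omega, c, h0, hc, rfl⟩
      · exact Or.inl ⟨k, by omega, rfl⟩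
      · rcases Nat.eq_zero_or_pos c with rfl | h0
        · exact Or.inl ⟨k + 1, le_rfl, by rw [List.replicate_succ']⟩
        · exact Or.inr ⟨k, by omega, c, h0, hc, rfl⟩
    · rintro (⟨j, hj, rfl⟩ | ⟨j, hj, c, h0, hc, rfl⟩)
      · rcases Nat.lt_or_ge j (k + 1) with h | h
        · exact Or.inl (Or.inl ⟨j, by omega, rfl⟩)
        · obtain rfl : j = k + 1 := by omega
          exact Or.inr (Or.inr ⟨0, by omega, by rw [List.replicate_succ']⟩)
      · rcases Nat.lt_or_ge j k with h | h
        · exact Or.inl (Or.inr ⟨j, h, c, h0, hc, rfl⟩)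
        · obtain rfl : j = k := by omega
          exact Or.inr (Or.inr ⟨c, hc, rfl⟩)

theorem mem_leaves (hn : 2 ≤ n) (w : List ℕ) :
    w ∈ (projTree n k).leaves ↔ w = List.replicate k 0 ∨
      ∃ j < k, ∃ c, 0 < c ∧ c < n ∧ w = List.replicate j 0 ++ [c] := by
  simp only [BranchTree.leaves, Finset.mem_filter, mem_verts hn]
  constructor
  · rintro ⟨⟨j, hj, rfl⟩ | h, hw⟩
    · rcases Nat.lt_or_ge j k with h | h
      · have := congrArg List.length (hw (List.replicate k 0) (Or.inl ⟨k, le_rfl, rfl⟩)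
          (by rw [show k = j + (k - j) by omega, List.replicate_add]; exact List.prefix_append _ _))
        simp at this
        omega
      · obtain rfl : j = k := by omega
        exact Or.inl rfl
    · exact Or.inr h
  · have aux : ∀ {j c i : ℕ} {v : List ℕ}, 0 < c →
        List.replicate j 0 ++ [c] <+: List.replicate i 0 ++ v →
        i ≤ j := by
      intro j c i v hc h
      by_contra hlt
      have := h.getElem (i := j) (by simp)
      rw [List.getElem_append_right (by simp), List.getElem_append_left (by simp; omega)] at this
      simp at this
      omega
    rintro (rfl | ⟨j, hj, c, h0, hc, rfl⟩)
    · refine ⟨Or.inl ⟨k, le_rfl, rfl⟩, ?_⟩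
      rintro w (⟨j, hj, rfl⟩ | ⟨j, hj, c, h0, hc, rfl⟩) h
      · exact (h.eq_of_length_le (by simpa using hj)).symm
      · exact (h.eq_of_length_le (by simp; omega)).symm
    · refine ⟨Or.inr ⟨j, hj, c, h0, hc, rfl⟩, ?_⟩
      rintro w (⟨i, hi, rfl⟩ | ⟨i, hi, d, h0', hd, rfl⟩) h
      · have := aux (v := []) h0 (by simpa using h)
        exact (h.eq_of_length_le (by simp; omega)).symm
      · exact (h.eq_of_length_le (by simpa using aux h0 h)).symm

theorem localOp_projTree (w : List ℕ) : (projTree n k).localOp w = projMinority := by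
  induction k generalizing w with
  | zero => rfl
  | succ k ih =>
    simp only [projTree, BranchTree.graft, starTree]
    split_ifs
    exacts [rfl, ih w]

/-- In each of these relations one coordinate determines the whole tuple. This makes all coordinates
of tuples from O_n select the same argument of the operation in `opClosed_pair`. -/
theorem OSym.eq_or_forall_ne {l : ℕ} (ρ : OSym n l) {y z : Fin l → O n} (hy : y ∈ ρ.interp)
    (hz : z ∈ ρ.interp) : y = z ∨ ∀ i, y i ≠ z i := by
  cases ρ with
  | unary Y =>
    by_cases h : y 0 = z 0
    · exact Or.inl (funext fun i => by rw [Subsingleton.elim i 0, h])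
    · exact Or.inr fun i => by rwa [Subsingleton.elim i 0]
  | graph σ =>
    replace hy : y 1 = σ (y 0) := hy
    replace hz : z 1 = σ (z 0) := hz
    by_cases h : y 0 = z 0
    · refine Or.inl (funext ?_)
      simp [Fin.forall_fin_two, hy, hz, h]
    · refine Or.inr ?_
      simp [Fin.forall_fin_two, hy, hz, h]
  | eq3 =>
    obtain ⟨h1, h2⟩ : y 0 = y 1 ∧ y 1 = y 2 := hy
    obtain ⟨h1', h2'⟩ : z 0 = z 1 ∧ z 1 = z 2 := hz
    by_cases h : y 0 = z 0
    · refine Or.inl (funext ?_)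
      rw [Fin.forall_fin_succ, Fin.forall_fin_succ, Fin.forall_fin_succ]
      simp [← h2, ← h1, ← h2', ← h1', h]
    · refine Or.inr ?_
      rw [Fin.forall_fin_succ, Fin.forall_fin_succ, Fin.forall_fin_succ]
      simp [← h2, ← h1, ← h2', ← h1', h]

/-- Under these hypotheses both coordinates select the same one of the three arguments, so the
result is one of the given tuples. -/
theorem opClosed_of_graph {S : Set (Fin 2 → P n k)}
    (heq : ∀ x ∈ S, ∀ y ∈ S, (x 0 = y 0 ↔ x 1 = y 1))
    (hmin : ∀ x ∈ S, ∀ y ∈ S, ∀ z ∈ S, x 0 ≠ y 0 → x 0 ≠ z 0 → y 0 ≠ z 0 →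
      (lev (x 0) < lev (y 0) ∧ lev (x 0) < lev (z 0) ↔
        lev (x 1) < lev (y 1) ∧ lev (x 1) < lev (z 1))) : OpClosed lev S := by
  intro x hx y hy z hz
  have := op_cases (lev := lev) (lev' := lev) (heq x hx y hy) (heq x hx z hz) (heq y hy z hz)
    (hmin x hx y hy z hz) (fun a b c => hmin z hz x hx y hy b.symm c.symm a)
  have ext : ∀ w : Fin 2 → P n k, op lev (x 0) (y 0) (z 0) = w 0 →
      op lev (x 1) (y 1) (z 1) = w 1 → (fun i => op lev (x i) (y i) (z i)) = w := by
    intro w h0 h1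
    refine funext ?_
    simp [Fin.forall_fin_two, h0, h1]
  rcases this with h | h | h <;> rw [ext _ h.1 h.2] <;> assumption

/-! ### Decomposing `P^{n,k+1}` into `P^{n,k}` and `O_n` -/

section Decomposition

variable [hn : Fact (2 ≤ n)]

/-- The leaf `0^k`. -/
def bot : P n k := ⟨List.replicate k 0, (mem_leaves hn.out _).2 (Or.inl rfl)⟩

/-- The embedding `ψ_0` of `P^{n,k}` into `P^{n,k+1}`. -/
def up (v : P n k) : P n (k + 1) := ⟨0 :: v.1, by
  refine (mem_leaves hn.out _).2 ?_
  rcases (mem_leaves hn.out _).1 v.2 with h | ⟨j, hj, c, h0, hc, h⟩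
  · exact Or.inl (by rw [h, List.replicate_succ])
  · exact Or.inr ⟨j + 1, by omega, c, h0, hc, by rw [h, List.replicate_succ, List.cons_append]⟩⟩

/-- The inclusion of `O_n` into `P^{n,k+1}`. -/
def incl (v : O n) : P n (k + 1) := ⟨v.1, by
  obtain ⟨c, h0, hc, h⟩ := v.2
  exact (mem_leaves hn.out _).2 (Or.inr ⟨0, by omega, c, h0, hc, by simpa using h⟩)⟩

theorem eq_up_or_eq_incl (v : P n (k + 1)) : (∃ a : P n k, v = up a) ∨ ∃ o : O n, v = incl o := by
  rcases (mem_leaves hn.out _).1 v.2 with h | ⟨j, hj, c, h0, hc, h⟩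
  · exact Or.inl ⟨bot, Subtype.ext (by rw [h, List.replicate_succ]; rfl)⟩
  · cases j with
    | zero => exact Or.inr ⟨⟨[c], c, h0, hc, rfl⟩, Subtype.ext (by rw [h]; rfl)⟩
    | succ j =>
      refine Or.inl ⟨⟨List.replicate j 0 ++ [c], (mem_leaves hn.out _).2
        (Or.inr ⟨j, by omega, c, h0, hc, rfl⟩)⟩, Subtype.ext ?_⟩
      rw [h, List.replicate_succ]
      rfl

theorem eq_bot_of_zero (v : P n 0) : v = bot := by
  rcases (mem_leaves hn.out _).1 v.2 with h | ⟨j, hj, -⟩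
  · exact Subtype.ext h
  · omega

theorem up_injective : Function.Injective (up : P n k → P n (k + 1)) := by
  intro a b h
  exact Subtype.ext (List.cons.inj (congrArg Subtype.val h)).2

theorem incl_injective : Function.Injective (incl : O n → P n (k + 1)) := by
  intro a b h
  exact Subtype.ext (congrArg Subtype.val h :)

@[simp] theorem up_inj {a b : P n k} : up a = up b ↔ a = b := up_injective.eq_iff

@[simp] theorem incl_inj {a b : O n} : (incl a : P n (k + 1)) = incl b ↔ a = b :=
  incl_injective.eq_iff

@[simp] theorem up_ne_incl (a : P n k) (b : O n) : up a ≠ incl b := by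
  intro h
  obtain ⟨c, h0, hc, hb⟩ := b.2
  have : (0 : ℕ) :: a.1 = [c] := (congrArg Subtype.val h :).trans hb
  simp at this
  omega

@[simp] theorem incl_ne_up (a : P n k) (b : O n) : incl b ≠ up a := (up_ne_incl a b).symm

theorem up_bot : up (bot : P n k) = bot := rfl

@[simp] theorem lev_up (a : P n k) : lev (up a) = lev a + 1 := rfl

@[simp] theorem lev_incl (o : O n) : lev (incl o : P n (k + 1)) = 0 := by
  obtain ⟨_, c, h0, hc, rfl⟩ := o
  obtain ⟨c, rfl⟩ : ∃ d, c = d + 1 := ⟨c - 1, by omega⟩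
  rfl

@[simp] theorem col_up (a : P n k) : col (up a) = col a := by simp [col, up]

theorem col_incl (o : O n) : col (incl o : P n (k + 1)) = o.1.sum := rfl

@[simp] theorem lev_bot : lev (bot : P n k) = k := by
  induction k with
  | zero => rfl
  | succ k ih => rw [← up_bot, lev_up, ih]

@[simp] theorem col_bot : col (bot : P n k) = 0 := by
  simp [col, bot]

theorem lev_le (v : P n k) : lev v ≤ k := by
  induction k with
  | zero => rw [eq_bot_of_zero v, lev_bot]
  | succ k ih =>
    rcases eq_up_or_eq_incl v with ⟨a, rfl⟩ | ⟨o, rfl⟩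
    · simpa using ih a
    · simp

theorem lev_eq_iff {v : P n k} : lev v = k ↔ v = bot := by
  refine ⟨fun h => ?_, fun h => h ▸ lev_bot⟩
  induction k with
  | zero => exact eq_bot_of_zero v
  | succ k ih =>
    rcases eq_up_or_eq_incl v with ⟨a, rfl⟩ | ⟨o, rfl⟩
    · rw [← up_bot, up_inj]
      exact ih (by simpa using h)
    · simp at h

theorem lev_lt_iff {v : P n k} : lev v < k ↔ v ≠ bot := by
  rw [Ne, ← lev_eq_iff]
  have := lev_le v
  omega

theorem ext_lev_col {v w : P n k} (h : lev v = lev w) (h' : col v = col w) : v = w := by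
  induction k with
  | zero => rw [eq_bot_of_zero v, eq_bot_of_zero w]
  | succ k ih =>
    rcases eq_up_or_eq_incl v with ⟨a, rfl⟩ | ⟨⟨_, c, _, _, rfl⟩, rfl⟩ <;>
      rcases eq_up_or_eq_incl w with ⟨b, rfl⟩ | ⟨⟨_, d, _, _, rfl⟩, rfl⟩
    · exact congrArg up (ih (by simpa using h) (by simpa using h'))
    · simp at h
    · simp at h
    · simp only [col_incl, List.sum_singleton] at h'
      subst h'
      rfl

theorem col_pos_iff {v : P n k} : 0 < col v ↔ v ≠ bot := by
  induction k with
  | zero => simp [eq_bot_of_zero v]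
  | succ k ih =>
    rcases eq_up_or_eq_incl v with ⟨a, rfl⟩ | ⟨o, rfl⟩
    · rw [← up_bot, col_up, ih, Ne, Ne, up_inj]
    · obtain ⟨_, c, h0, hc, rfl⟩ := o
      rw [← up_bot]
      simp [col_incl, h0]

theorem exists_lev_col {j c : ℕ} (hj : j < k) (hc0 : 0 < c) (hc : c < n) :
    ∃ v : P n k, lev v = j ∧ col v = c := by
  induction k generalizing j with
  | zero => omega
  | succ k ih =>
    cases j with
    | zero => exact ⟨incl ⟨[c], c, hc0, hc, rfl⟩, by simp, by simp [col_incl]⟩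
    | succ j =>
      obtain ⟨v, h, h'⟩ := ih (j := j) (by omega)
      exact ⟨up v, by simp [h], by simp [h']⟩

theorem col_lt (v : P n k) : col v < n := by
  have := hn.out
  induction k with
  | zero => rw [eq_bot_of_zero v, col_bot]; omega
  | succ k ih =>
    rcases eq_up_or_eq_incl v with ⟨a, rfl⟩ | ⟨⟨_, c, -, hc, rfl⟩, rfl⟩
    · simpa using ih a
    · simpa [col_incl] using hc

theorem exists_lev_col_of_ne {j : ℕ} (v : P n k) (hv : v ≠ bot) (hj : j < k) :
    ∃ w : P n k, lev w = j ∧ col w = col v :=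
  exists_lev_col hj (col_pos_iff.2 hv) (col_lt v)

theorem op_up (a b c : P n k) : op lev (up a) (up b) (up c) = up (op lev a b c) :=
  op_map up_injective (fun x y => by simp) a b c

theorem leafOp_up (a b c : P n k) :
    (projTree n (k + 1)).leafOp (up a) (up b) (up c) = up ((projTree n k).leafOp a b c) := by
  have hl : lcp (up a).1 (lcp (up b).1 (up c).1) = 0 :: lcp a.1 (lcp b.1 c.1) := by
    simp [up, lcp]
  have hc : ∀ (d : List ℕ) (v : P n k), childOn (0 :: d) (up v).1 = childOn d v.1 := by
    intro d v
    simp [childOn, up]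
  simp only [BranchTree.leafOp, hl, hc, localOp_projTree, up_inj]
  split_ifs <;> rfl

theorem lcp_lcp_eq_nil {a b c : List ℕ} {x y z : ℕ}
    (h : ¬(x = y ∧ y = z)) : lcp (x :: a) (lcp (y :: b) (z :: c)) = [] := by
  by_cases hyz : y = z
  · have hxy : x ≠ y := fun e => h ⟨e, hyz⟩
    simp [lcp, hyz, hyz ▸ hxy]
  · simp [lcp, hyz]

/-- Evaluation of the operation when the join of the arguments is the root. -/
theorem leafOp_eq_op_of_head {a b c : P n (k + 1)} {x y z : ℕ} {a' b' c' : List ℕ}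
    (ha : a.1 = x :: a') (hb : b.1 = y :: b') (hc : c.1 = z :: c') (h : ¬(x = y ∧ y = z)) :
    (projTree n (k + 1)).leafOp a b c = op lev a b c := by
  have hd : ∀ {v : P n (k + 1)} {x : ℕ} {v' : List ℕ}, v.1 = x :: v' →
      (lev v = 0 ∧ x ≠ 0 ∧ v' = []) ∨ (0 < lev v ∧ x = 0) := by
    intro v x v' hv
    rcases eq_up_or_eq_incl v with ⟨u, rfl⟩ | ⟨⟨_, d, hd, _, rfl⟩, rfl⟩
    · exact Or.inr ⟨by simp, (List.cons.inj hv).1.symm⟩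
    · obtain ⟨rfl, rfl⟩ := List.cons.inj hv
      exact Or.inl ⟨by simp, by omega, rfl⟩
  have hab : x ≠ y → a ≠ b := by
    rintro h rfl
    exact h (List.cons.inj (ha.symm.trans hb)).1
  have hac : x ≠ z → a ≠ c := by
    rintro h rfl
    exact h (List.cons.inj (ha.symm.trans hc)).1
  have hbc : y ≠ z → b ≠ c := by
    rintro h rfl
    exact h (List.cons.inj (hb.symm.trans hc)).1
  have hab' : x = y → x ≠ 0 → a = b := by
    rintro rfl h
    have h1 := hd ha
    have h2 := hd hb
    exact Subtype.ext (by rw [ha, hb]; grind)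
  have hac' : x = z → x ≠ 0 → a = c := by
    rintro rfl h
    have h1 := hd ha
    have h2 := hd hc
    exact Subtype.ext (by rw [ha, hc]; grind)
  have hbc' : y = z → y ≠ 0 → b = c := by
    rintro rfl h
    have h1 := hd hb
    have h2 := hd hc
    exact Subtype.ext (by rw [hb, hc]; grind)
  have h1 := hd ha
  have h2 := hd hb
  have h3 := hd hc
  have hne : ¬(a = b ∧ b = c) := by
    rintro ⟨rfl, rfl⟩
    grind
  simp only [BranchTree.leafOp, if_neg hne, localOp_projTree]
  rw [ha, hb, hc, lcp_lcp_eq_nil h]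
  simp only [childOn, List.length_nil, List.getD_cons_zero, projMinority, op]
  clear ha hb hc hd
  grind

/-- If one of three distinct leaves has strictly least level, the other two continue through 0 at
the join, and the minority is the shallow leaf. Otherwise the children at the join are pairwise
distinct, and the second is selected. The induction strips a common leading 0. -/
theorem leafOp_eq_op (a b c : P n k) : (projTree n k).leafOp a b c = op lev a b c := by
  induction k with
  | zero =>
    rw [eq_bot_of_zero a, eq_bot_of_zero b, eq_bot_of_zero c, op_left]
    simp [BranchTree.leafOp]
  | succ k ih =>
    by_cases h : a = b ∧ b = c
    · obtain ⟨rfl, rfl⟩ := h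
      simp [BranchTree.leafOp]
    · rcases eq_up_or_eq_incl a with ⟨a, rfl⟩ | ⟨⟨_, a, ha, _, rfl⟩, rfl⟩ <;>
        rcases eq_up_or_eq_incl b with ⟨b, rfl⟩ | ⟨⟨_, b, hb, _, rfl⟩, rfl⟩ <;>
          rcases eq_up_or_eq_incl c with ⟨c, rfl⟩ | ⟨⟨_, c, hc, _, rfl⟩, rfl⟩
      · rw [leafOp_up, ih, op_up]
      all_goals
        refine leafOp_eq_op_of_head rfl rfl rfl ?_
        first
        | omega
        | simpa only [incl_inj, Subtype.mk.injEq, List.cons.injEq, and_true] using h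

end Decomposition

end LeafAlgebra

/-! ### The basic relations are invariant under the basic operation. -/

section BasicRelations

variable {n k : ℕ} [hn : Fact (2 ≤ n)]

/-! ### Explicit descriptions of the basic relations -/

theorem psi_zero_eq (v : P n k) : psi k 0 v.1 = (up v).1 := by
  unfold psi up
  rcases (mem_leaves hn.out _).1 v.2 with h | ⟨j, hj, c, h0, hc, h⟩
  · simp [h, List.replicate_succ]
  · split_ifs with h1 h2
    · simp [h1, List.replicate_succ]
    · rfl
    · simp [h] at h2

theorem eq_psi_self_iff (v : P n k) (w : P n (k + 1)) :
    w.1 = psi k k v.1 ↔ col w = col v ∧ lev w = if lev v = k then k + 1 else lev v := by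
  by_cases hv : v = bot
  · subst hv
    have : psi k k (bot : P n k).1 = (bot : P n (k + 1)).1 := by simp [psi, bot]
    rw [this, ← Subtype.ext_iff, lev_bot, if_pos rfl, lev_eq_iff, col_bot]
    exact ⟨fun h => by simp [h], fun h => h.2⟩
  · have hv' : v.1 ≠ List.replicate k 0 := fun h => hv (Subtype.ext h)
    obtain ⟨j, hj, c, h0, hc, h⟩ := ((mem_leaves hn.out _).1 v.2).resolve_left hv'
    have hpsi : psi k k v.1 = v.1 := by
      rw [psi, if_neg hv', if_neg]
      rw [h]
      simp
      omega
    rw [hpsi, if_neg (fun e => hv (lev_eq_iff.1 e))]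
    constructor
    · intro e
      exact ⟨congrArg List.sum e, congrArg leadZeros e⟩
    · rintro ⟨h1, h2⟩
      have hw : v.1 ∈ (projTree n (k + 1)).leaves :=
        (mem_leaves hn.out _).2 (Or.inr ⟨j, by omega, c, h0, hc, h⟩)
      exact congrArg Subtype.val (ext_lev_col (w := ⟨v.1, hw⟩) h2 h1)

theorem mem_oplus {l : ℕ} {S : Set (Fin l → P n k)} {Y : Set (Fin l → O n)}
    {t : Fin l → P n (k + 1)} :
    t ∈ oplus S Y ↔ (∃ s ∈ S, ∀ i, t i = up (s i)) ∨ ∃ y ∈ Y, ∀ i, t i = incl (y i) := by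
  have h' : ∀ v : O n, v.1 = (incl v : P n (k + 1)).1 := fun v => rfl
  simp only [oplus, psi_zero_eq, h', ← Subtype.ext_iff]
  rfl

theorem mem_pair {l : ℕ} {ρ : PSym n k l} {ρ' : OSym n l} {t : Fin l → P n (k + 1)} :
    t ∈ (PSym.pair ρ ρ').interp ↔
      (∃ s ∈ ρ.interp, ∀ i, t i = up (s i)) ∨ ∃ y ∈ ρ'.interp, ∀ i, t i = incl (y i) :=
  mem_oplus

theorem mem_transfer {t : Fin 2 → P n (k + 1)} :
    t ∈ (PSym.transfer : PSym n (k + 1) 2).interp ↔ lev (t 0) ≠ 0 ∧ col (t 1) = col (t 0) ∧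
      lev (t 1) = if lev (t 0) = k + 1 then k + 1 else lev (t 0) - 1 := by
  have : t ∈ (PSym.transfer : PSym n (k + 1) 2).interp ↔
      ∃ a : P n k, (t 0).1 = psi k 0 a.1 ∧ (t 1).1 = psi k k a.1 := Iff.rfl
  simp only [this, psi_zero_eq, eq_psi_self_iff, ← Subtype.ext_iff]
  constructor
  · rintro ⟨a, h, h1, h2⟩
    simp [h, h1, h2]
  · rintro ⟨h, h1, h2⟩
    rcases eq_up_or_eq_incl (t 0) with ⟨a, ha⟩ | ⟨o, ho⟩
    · exact ⟨a, ha, by simpa [ha] using h1, by simpa [ha] using h2⟩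
    · simp [ho] at h

/-- The leaf `0^k 1` of `P^{n,k+1}`. -/
def one : (k : ℕ) → P n (k + 1)
  | 0 => incl ⟨[1], 1, one_pos, hn.out, rfl⟩
  | k + 1 => up (one k)

theorem up_one : up (one k : P n (k + 1)) = one (k + 1) := rfl

@[simp] theorem lev_one : lev (one k : P n (k + 1)) = k := by
  induction k with
  | zero => exact lev_incl _
  | succ k ih => rw [← up_one, lev_up, ih]

theorem one_ne_bot : (one k : P n (k + 1)) ≠ bot := by
  rw [← lev_lt_iff, lev_one]
  omega

theorem eq_one_of_val (v : P n 1) : v.1 = [1] ↔ v = (one 0 : P n 1) :=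
  ⟨fun h => Subtype.ext h, fun h => h ▸ rfl⟩

theorem eq_bot_of_val (v : P n 1) : v.1 = [0] ↔ v = bot :=
  ⟨fun h => Subtype.ext h, fun h => h ▸ rfl⟩

theorem mem_swap {t : Fin 2 → P n 1} :
    t ∈ (PSym.swap : PSym n 1 2).interp ↔ t 1 = Equiv.swap bot (one 0) (t 0) := by
  have : (Equiv.swap (bot : P n 1) (one 0) (t 0)).1 = Equiv.swap [0] [1] (t 0).1 := by
    simp only [Equiv.swap_apply_def, eq_one_of_val, eq_bot_of_val]
    split_ifs <;> rfl
  rw [Subtype.ext_iff, this]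
  rfl

/-- The odd parity relation on a pair of elements. -/
def OddTriple {A : Type} (u v x y z : A) : Prop :=
  (x = u ∧ y = u ∧ z = u) ∨ (x = u ∧ y = v ∧ z = v) ∨ (x = v ∧ y = u ∧ z = v) ∨
    (x = v ∧ y = v ∧ z = u)

theorem mem_lin {t : Fin 3 → P n 1} :
    t ∈ (PSym.lin : PSym n 1 3).interp ↔ OddTriple (A := P n 1) (one 0) bot (t 0) (t 1) (t 2) := by
  have h : ∀ a b c : List ℕ, (fun i => (t i).1) = ![a, b, c] ↔
      (t 0).1 = a ∧ (t 1).1 = b ∧ (t 2).1 = c := by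
    intro a b c
    rw [funext_iff, Fin.forall_fin_succ, Fin.forall_fin_succ, Fin.forall_fin_succ]
    simp
  simp only [OddTriple, ← eq_one_of_val, ← eq_bot_of_val, ← h]
  rfl

/-! ### The basic operation is a polymorphism -/

/-- Leaves of O_n have level 0 and those in the image of ψ_0 have positive level. Hence the pattern
of the three tuples, together with the alternative "equal or different everywhere" for tuples over
O_n, decides which argument is returned, simultaneously in all coordinates. -/
theorem opClosed_pair {l : ℕ} {ρ : PSym n k l} (h : OpClosed lev ρ.interp) (ρ' : OSym n l) :
    OpClosed lev (PSym.pair ρ ρ').interp := by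
  have uui : ∀ (a b : P n k) (c : O n), op lev (up a) (up b) (incl c) = incl c := by
    intro a b c; unfold op; simp
  have uiu : ∀ (a b : P n k) (c : O n), op lev (up a) (incl c) (up b) = incl c := by
    intro a b c; unfold op; simp
  have iuu : ∀ (a b : P n k) (c : O n), op lev (incl c) (up a) (up b) = incl c := by
    intro a b c; unfold op; simp
  have uii : ∀ (a : P n k) (c d : O n), c ≠ d → op lev (up a) (incl c) (incl d) = incl c := by
    intro a c d h; unfold op; simp [h]
  have iui : ∀ (a : P n k) (c d : O n), op lev (incl c) (up a) (incl d) = up a := by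
    intro a c d; unfold op; simp
  have iiu : ∀ (a : P n k) (c d : O n), c ≠ d → op lev (incl c) (incl d) (up a) = incl d := by
    intro a c d h; unfold op; simp [h]
  have iii : ∀ (c d e : O n), c ≠ d → c ≠ e → d ≠ e →
      op lev (incl c : P n (k + 1)) (incl d) (incl e) = incl d := by
    intro c d e h h' h''; unfold op; simp [h, h', h'']
  intro x hx y hy z hz
  rw [mem_pair] at hx hy hz ⊢
  rcases hx with ⟨x', hx', hx⟩ | ⟨x', hx', hx⟩ <;> rcases hy with ⟨y', hy', hy⟩ | ⟨y', hy', hy⟩ <;>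
    rcases hz with ⟨z', hz', hz⟩ | ⟨z', hz', hz⟩ <;> simp only [hx, hy, hz]
  · exact Or.inl ⟨_, h x' hx' y' hy' z' hz', fun i => op_up _ _ _⟩
  · exact Or.inr ⟨z', hz', fun i => uui _ _ _⟩
  · exact Or.inr ⟨y', hy', fun i => uiu _ _ _⟩
  · rcases ρ'.eq_or_forall_ne hy' hz' with rfl | hne
    · exact Or.inl ⟨x', hx', fun i => op_right _ _⟩
    · exact Or.inr ⟨y', hy', fun i => uii _ _ _ (hne i)⟩
  · exact Or.inr ⟨x', hx', fun i => iuu _ _ _⟩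
  · exact Or.inl ⟨y', hy', fun i => iui _ _ _⟩
  · rcases ρ'.eq_or_forall_ne hx' hy' with rfl | hne
    · exact Or.inl ⟨z', hz', fun i => op_left _ _⟩
    · exact Or.inr ⟨y', hy', fun i => iiu _ _ _ (hne i)⟩
  · rcases ρ'.eq_or_forall_ne hx' hy' with rfl | hxy
    · exact Or.inr ⟨z', hz', fun i => op_left _ _⟩
    rcases ρ'.eq_or_forall_ne hx' hz' with rfl | hxz
    · exact Or.inr ⟨y', hy', fun i => op_mid _ _⟩
    rcases ρ'.eq_or_forall_ne hy' hz' with rfl | hyz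
    · exact Or.inr ⟨x', hx', fun i => op_right _ _⟩
    exact Or.inr ⟨y', hy', fun i => iii _ _ _ (hxy i) (hxz i) (hyz i)⟩

theorem opClosed_interp {l : ℕ} (ρ : PSym n k l) : OpClosed lev ρ.interp := by
  induction ρ with
  | empty => intro x hx; exact hx.elim
  | single => intro x _ y _ z _; exact congrArg Subtype.val (eq_bot_of_zero _)
  | eq2 => intro x _ y _ z _; exact (eq_bot_of_zero _).trans (eq_bot_of_zero _).symm
  | eq3 =>
    intro x _ y _ z _
    exact ⟨(eq_bot_of_zero _).trans (eq_bot_of_zero _).symm,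
      (eq_bot_of_zero _).trans (eq_bot_of_zero _).symm⟩
  | pair ρ ρ' ih => exact opClosed_pair ih ρ'
  | full => intro x _ y _ z _; trivial
  | @transfer k =>
    -- The level of the second coordinate is a strictly increasing function of that of the first: it
    -- drops by one, except at the deepest leaf.
    have hl : ∀ x ∈ (PSym.transfer : PSym n (k + 1) 2).interp,
        ∀ y ∈ (PSym.transfer : PSym n (k + 1) 2).interp,
        (lev (x 0) < lev (y 0) ↔ lev (x 1) < lev (y 1)) := by
      intro x hx y hy
      rw [mem_transfer] at hx hy
      have := lev_le (x 0)
      have := lev_le (y 0)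
      have := lev_le (x 1)
      have := lev_le (y 1)
      grind
    refine opClosed_of_graph (fun x hx y hy => ⟨fun h => ?_, fun h => ?_⟩) ?_
    · have := hl x hx y hy
      have := hl y hy x hx
      rw [mem_transfer] at hx hy
      exact ext_lev_col (by rw [h] at *; omega) (by rw [hx.2.1, hy.2.1, h])
    · have := hl x hx y hy
      have := hl y hy x hx
      rw [mem_transfer] at hx hy
      exact ext_lev_col (by rw [h] at *; omega) (by rw [← hx.2.1, ← hy.2.1, h])
    · intro x hx y hy z hz _ _ _
      rw [hl x hx y hy, hl x hx z hz]
  | swap =>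
    -- The levels in P^{n,1} are 0 and 1, and only one leaf has level 1, so no leaf lies strictly
    -- above two different ones.
    have hm : ∀ x y z : P n 1, y ≠ z → ¬(lev x < lev y ∧ lev x < lev z) := by
      rintro x y z h ⟨h1, h2⟩
      have h1' := lev_le y
      have h2' := lev_le z
      exact h ((lev_eq_iff.1 (by omega)).trans (lev_eq_iff.1 (by omega)).symm)
    refine opClosed_of_graph (fun x hx y hy => ?_) ?_
    · rw [mem_swap] at hx hy
      rw [hx, hy, Equiv.apply_eq_iff_eq]
    · intro x hx y hy z hz _ _ hyz
      rw [mem_swap] at hx hy hz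
      refine iff_of_false (hm _ _ _ hyz) (hm _ _ _ ?_)
      rwa [hy, hz, Ne, Equiv.apply_eq_iff_eq]
  | lin =>
    intro x hx y hy z hz
    rw [mem_lin] at hx hy hz ⊢
    -- On two elements a minority is x + y + z modulo 2; among three arguments two always coincide,
    -- so the minority identities settle all cases.
    rcases hx with ⟨h1, h2, h3⟩ | ⟨h1, h2, h3⟩ | ⟨h1, h2, h3⟩ | ⟨h1, h2, h3⟩ <;>
    rcases hy with ⟨h4, h5, h6⟩ | ⟨h4, h5, h6⟩ | ⟨h4, h5, h6⟩ | ⟨h4, h5, h6⟩ <;>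
    rcases hz with ⟨h7, h8, h9⟩ | ⟨h7, h8, h9⟩ | ⟨h7, h8, h9⟩ | ⟨h7, h8, h9⟩ <;>
    simp only [OddTriple, h1, h2, h3, h4, h5, h6, h7, h8, h9, op_left, op_mid, op_right, true_and,
      true_or, or_true, and_true]

theorem mem_inv_basicOps_iff (R : Rel (P n k)) :
    R ∈ Inv (projTree n k).basicOps ↔ OpClosed lev R.2 := by
  simp only [Inv, BranchTree.basicOps, Set.mem_singleton_iff, forall_eq, Preserves, OpClosed,
    leafOp_eq_op]
  constructor
  · intro h x hx y hy z hz
    have := h ![x, y, z] (by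
      intro i
      fin_cases i
      exacts [hx, hy, hz])
    exact this
  · intro h t ht
    exact h _ (ht 0) _ (ht 1) _ (ht 2)

theorem basicOps_subset_pol :
    (projTree n k).basicOps ⊆ Pol (sig n k) (P n k) := by
  rintro f hf
  refine ⟨by rw [Set.mem_singleton_iff.1 hf]; norm_num, fun l ρ => ?_⟩
  exact (mem_inv_basicOps_iff (basicRel (sig n k) (P n k) ρ)).2 (opClosed_interp ρ) f hf

end BasicRelations

/-! ### Definable retractions, shifts, transpositions and level-preserving bijections. -/

section Definability

variable {n k : ℕ} [hn : Fact (2 ≤ n)]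

/-! ### Definable relations -/

theorem exists_unary (U : P n k → Prop) : ∃ ρ : PSym n k 1, ∀ t, t ∈ ρ.interp ↔ U (t 0) := by
  induction k with
  | zero =>
    by_cases h : U bot
    · refine ⟨.single, fun t => iff_of_true ?_ (by rwa [eq_bot_of_zero (t 0)])⟩
      exact congrArg Subtype.val (eq_bot_of_zero (t 0))
    · exact ⟨.empty, fun t => iff_of_false id (by rwa [eq_bot_of_zero (t 0)])⟩
  | succ k ih =>
    obtain ⟨ρ, hρ⟩ := ih fun a => U (up a)
    refine ⟨.pair ρ (.unary {o | U (incl o)}), fun t => ?_⟩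
    rw [mem_pair]
    simp only [Fin.forall_fin_one, hρ, OSym.interp]
    constructor
    · rintro (⟨s, h, e⟩ | ⟨y, h, e⟩)
      · rwa [e]
      · rw [e]; exact h
    · intro h
      rcases eq_up_or_eq_incl (t 0) with ⟨a, ha⟩ | ⟨o, ho⟩
      · exact Or.inl ⟨fun _ => a, by rwa [← ha], ha⟩
      · exact Or.inr ⟨fun _ => o, show U (incl o) by rwa [← ho], ho⟩

theorem pp1 (U : P n k → Prop) : PP1 n k U := by
  obtain ⟨ρ, hρ⟩ := exists_unary U
  exact (PPd.sym ρ).congr fun t => (hρ t).symm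

/-- The retraction that collapses everything of level at least `d` to `0^k`. -/
def ret (d : ℕ) (x : P n k) : P n k := if d ≤ lev x then bot else x

theorem mem_pair_two {ρ : PSym n k 2} {ρ' : OSym n 2} {t : Fin 2 → P n (k + 1)} :
    t ∈ (PSym.pair ρ ρ').interp ↔
      (∃ a b, ![a, b] ∈ ρ.interp ∧ t 0 = up a ∧ t 1 = up b) ∨
        ∃ a b, ![a, b] ∈ ρ'.interp ∧ t 0 = incl a ∧ t 1 = incl b := by
  rw [mem_pair]
  simp only [Fin.forall_fin_two]
  have e : ∀ {A : Type} (s : Fin 2 → A), s = ![s 0, s 1] := by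
    intro A s; refine funext ?_; simp [Fin.forall_fin_two]
  constructor
  · rintro (⟨s, h, e1, e2⟩ | ⟨s, h, e1, e2⟩)
    · exact Or.inl ⟨s 0, s 1, e s ▸ h, e1, e2⟩
    · exact Or.inr ⟨s 0, s 1, e s ▸ h, e1, e2⟩
  · rintro (⟨a, b, h, e1, e2⟩ | ⟨a, b, h, e1, e2⟩)
    · exact Or.inl ⟨_, h, e1, e2⟩
    · exact Or.inr ⟨_, h, e1, e2⟩

/-- Extending a binary symbol by the identity on `O_n`. -/
theorem mem_pair_refl {ρ : PSym n k 2} {E : P n k → P n k → Prop}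
    (hρ : ∀ t, t ∈ ρ.interp ↔ E (t 0) (t 1)) {t : Fin 2 → P n (k + 1)} :
    t ∈ (PSym.pair ρ (.graph (Equiv.refl _))).interp ↔
      (∃ a b, E a b ∧ t 0 = up a ∧ t 1 = up b) ∨ ∃ o, t 0 = incl o ∧ t 1 = incl o := by
  rw [mem_pair_two]
  simp only [hρ]
  refine or_congr Iff.rfl ⟨?_, ?_⟩
  · rintro ⟨a, b, h, h1, h2⟩
    obtain rfl : b = a := h
    exact ⟨b, h1, h2⟩
  · rintro ⟨o, h1, h2⟩
    exact ⟨o, o, rfl, h1, h2⟩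

/-- The symbol is the full relation on P^{n,k-d}, extended d times by the identity of O_n; for d = k
one starts from equality on the single point. -/
theorem exists_ker_ret {d : ℕ} (hd : d ≤ k) :
    ∃ ρ : PSym n k 2, ∀ t, t ∈ ρ.interp ↔ ret d (t 0) = ret d (t 1) := by
  induction k generalizing d with
  | zero =>
    exact ⟨.eq2, fun t => iff_of_true ((eq_bot_of_zero _).trans (eq_bot_of_zero _).symm)
      ((eq_bot_of_zero _).trans (eq_bot_of_zero _).symm)⟩
  | succ k ih =>
    cases d with
    | zero => exact ⟨.full, fun t => iff_of_true trivial (by simp [ret])⟩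
    | succ d =>
      obtain ⟨ρ, hρ⟩ := ih (d := d) (by omega)
      have hup : ∀ a : P n k, ret (d + 1) (up a) = up (ret d a) := by
        intro a
        unfold ret
        simp only [lev_up, Nat.add_le_add_iff_right]
        split_ifs <;> rfl
      have hincl : ∀ o : O n, ret (d + 1) (incl o : P n (k + 1)) = incl o := by
        intro o
        simp [ret]
      refine ⟨.pair ρ (.graph (Equiv.refl _)), fun t => ?_⟩
      rw [mem_pair_refl (E := fun x y => ret d x = ret d y) hρ]
      rcases eq_up_or_eq_incl (t 0) with ⟨a, ha⟩ | ⟨a, ha⟩ <;>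
        rcases eq_up_or_eq_incl (t 1) with ⟨b, hb⟩ | ⟨b, hb⟩ <;>
        simp [ha, hb, hup, hincl, eq_comm]

theorem ret_ret (d : ℕ) (x : P n k) : ret d (ret d x) = ret d x := by
  unfold ret
  split_ifs <;> rfl

/-- Each class of the kernel contains exactly one fixed point of the retraction, and being fixed is
a definable unary condition. -/
theorem pp2_ret {d : ℕ} (hd : d ≤ k) : PP2 n k fun x z => z = ret d x := by
  obtain ⟨ρ, hρ⟩ := exists_ker_ret (n := n) hd
  have h : PP2 n k fun x z => ret d x = ret d z := (PPd.sym ρ).congr fun t => (hρ t).symm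
  refine (h.and_right (pp1 fun z => ret d z = z)).congr fun x z => ⟨?_, ?_⟩
  · rintro rfl
    simp [ret_ret]
  · rintro ⟨h1, h2⟩
    rw [h1, h2]

/-- This closes the gap left by an empty level i. The canonical transfer relation is the case i = 0,
and each extension by the identity of O_n raises i by one. -/
theorem exists_shift {i : ℕ} (hi : i < k) : ∃ ρ : PSym n k 2, ∀ t, t ∈ ρ.interp ↔
    lev (t 0) ≠ i ∧ col (t 1) = col (t 0) ∧
      lev (t 1) = if lev (t 0) < i ∨ lev (t 0) = k then lev (t 0) else lev (t 0) - 1 := by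
  induction k generalizing i with
  | zero => omega
  | succ k ih =>
    cases i with
    | zero =>
      refine ⟨.transfer, fun t => mem_transfer.trans ?_⟩
      refine and_congr Iff.rfl (and_congr Iff.rfl ?_)
      simp only [not_lt_zero, false_or]
      split_ifs with h <;> simp [h]
    | succ i =>
      obtain ⟨ρ, hρ⟩ := ih (i := i) (by omega)
      refine ⟨.pair ρ (.graph (Equiv.refl _)), fun t => ?_⟩
      rw [mem_pair_refl (E := fun x y => lev x ≠ i ∧ col y = col x ∧
        lev y = if lev x < i ∨ lev x = k then lev x else lev x - 1) hρ]
      constructor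
      · rintro (⟨a, b, ⟨h1, h2, h3⟩, ha, hb⟩ | ⟨o, h1, h2⟩)
        · simp only [ha, hb, lev_up, col_up]
          grind
        · simp [h1, h2]
      · rintro ⟨h1, h2, h3⟩
        rcases eq_up_or_eq_incl (t 0) with ⟨a, ha⟩ | ⟨a, ha⟩ <;>
          rcases eq_up_or_eq_incl (t 1) with ⟨b, hb⟩ | ⟨b, hb⟩
        · refine Or.inl ⟨a, b, ?_, ha, hb⟩
          simp only [ha, hb, lev_up, col_up] at h1 h2 h3
          grind
        · simp only [ha, hb, lev_up, lev_incl] at h1 h3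
          grind
        · simp [ha, hb] at h3
        · refine Or.inr ⟨a, ha, ?_⟩
          rw [hb, ← ha]
          refine ext_lev_col ?_ (by rw [← hb, h2])
          simp [ha]

/-- Moving the level `i` to the level `i + 1`, which has to be empty before. -/
theorem pp2_move {i : ℕ} (hi : i + 1 < k) : PP2 n k fun x y =>
    lev x ≠ i + 1 ∧ col y = col x ∧ lev y = if lev x = i then i + 1 else lev x := by
  obtain ⟨ρ, hρ⟩ := exists_shift (n := n) hi
  obtain ⟨ρ', hρ'⟩ := exists_shift (n := n) (show i < k by omega)
  have h : PP2 n k fun x z => lev x ≠ i + 1 ∧ col z = col x ∧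
      lev z = if lev x < i + 1 ∨ lev x = k then lev x else lev x - 1 :=
    (PPd.sym ρ).congr fun t => (hρ t).symm
  have h' : PP2 n k fun x z => lev x ≠ i ∧ col z = col x ∧
      lev z = if lev x < i ∨ lev x = k then lev x else lev x - 1 :=
    (PPd.sym ρ').congr fun t => (hρ' t).symm
  -- The shift at i + 1 closes the empty level i + 1, and the inverse of the shift at i opens a gap
  -- at level i instead.
  refine (h.comp h'.symm).congr fun x y => ⟨?_, ?_⟩
  · rintro ⟨h1, h2, h3⟩
    have hx := lev_le x
    have hbot := lev_eq_iff (v := x)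
    obtain ⟨z, hz1, hz2⟩ : ∃ z : P n k,
        lev z = (if lev x < i + 1 ∨ lev x = k then lev x else lev x - 1) ∧ col z = col x := by
      by_cases hxb : x = bot
      · exact ⟨x, by simp [hbot.2 hxb], rfl⟩
      · exact exists_lev_col_of_ne x hxb (by
          have : lev x ≠ k := fun e => hxb (hbot.1 e)
          split_ifs <;> omega)
    refine ⟨z, ⟨h1, hz2, hz1⟩, ?_, by rw [hz2, h2], ?_⟩ <;> grind
  · rintro ⟨z, ⟨h1, h2, h3⟩, h4, h5, h6⟩
    refine ⟨h1, by rw [← h5, h2], ?_⟩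
    have hx := lev_le x
    have hy := lev_le y
    grind

/-- The special relations are basic only in P^{n,1}; extension by the identity of O_n carries them
to the last star of the tree. -/
theorem exists_swap : ∃ ρ : PSym n (k + 1) 2,
    ∀ t, t ∈ ρ.interp ↔ t 1 = Equiv.swap bot (one k) (t 0) := by
  induction k with
  | zero => exact ⟨.swap, fun t => mem_swap⟩
  | succ k ih =>
    obtain ⟨ρ, hρ⟩ := ih
    refine ⟨.pair ρ (.graph (Equiv.refl _)), fun t => ?_⟩
    rw [mem_pair_refl (E := fun x y => y = Equiv.swap bot (one k) x) hρ,
      show (bot : P n (k + 2)) = up bot from rfl, ← up_one]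
    rcases eq_up_or_eq_incl (t 0) with ⟨a, ha⟩ | ⟨a, ha⟩ <;> rw [ha]
    · rw [up_injective.swap_apply]
      simp
    · rw [Equiv.swap_apply_of_ne_of_ne (by simp) (by simp)]
      simp

theorem pp2_swap_one : PP2 n (k + 1) fun x y => y = Equiv.swap bot (one k) x := by
  obtain ⟨ρ, hρ⟩ := exists_swap (n := n) (k := k)
  exact (PPd.sym ρ).congr fun t => (hρ t).symm

theorem exists_lin : ∃ ρ : PSym n (k + 1) 3, ∀ t, t ∈ ρ.interp ↔
    (lev (t 0) < k ∧ t 0 = t 1 ∧ t 1 = t 2) ∨ OddTriple (one k) bot (t 0) (t 1) (t 2) := by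
  induction k with
  | zero => exact ⟨.lin, fun t => by simpa using mem_lin⟩
  | succ k ih =>
    obtain ⟨ρ, hρ⟩ := ih
    refine ⟨.pair ρ .eq3, fun t => ?_⟩
    rw [mem_pair]
    simp only [hρ, OSym.interp, Fin.forall_fin_succ, IsEmpty.forall_iff, and_true]
    constructor
    · rintro (⟨s, h, h1, h2, h3⟩ | ⟨y, ⟨h, h'⟩, h1, h2, h3⟩)
      · replace h2 : t 1 = up (s 1) := h2
        replace h3 : t 2 = up (s 2) := h3
        rw [show (bot : P n (k + 2)) = up bot from rfl, ← up_one]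
        simpa only [h1, h2, h3, lev_up, up_inj, OddTriple, Nat.add_lt_add_iff_right] using h
      · left
        simp_all
    · rintro (⟨h, h1, h2⟩ | h)
      · rcases eq_up_or_eq_incl (t 0) with ⟨a, ha⟩ | ⟨a, ha⟩
        · refine Or.inl ⟨fun _ => a, Or.inl ⟨?_, rfl, rfl⟩, ha, ?_, ?_⟩
          · simpa [ha] using h
          · exact h1.symm.trans ha
          · exact h2.symm.trans (h1.symm.trans ha)
        · refine Or.inr ⟨fun _ => a, ⟨rfl, rfl⟩, ha, ?_, ?_⟩
          · exact h1.symm.trans ha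
          · exact h2.symm.trans (h1.symm.trans ha)
      · left
        rw [← up_one, ← up_bot] at h
        rcases h with ⟨h1, h2, h3⟩ | ⟨h1, h2, h3⟩ | ⟨h1, h2, h3⟩ | ⟨h1, h2, h3⟩
        · exact ⟨![one k, one k, one k], Or.inr (by simp [OddTriple]), h1, h2, h3⟩
        · exact ⟨![one k, bot, bot], Or.inr (by simp [OddTriple]), h1, h2, h3⟩
        · exact ⟨![bot, one k, bot], Or.inr (by simp [OddTriple]), h1, h2, h3⟩
        · exact ⟨![bot, bot, one k], Or.inr (by simp [OddTriple]), h1, h2, h3⟩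

theorem pp3_lin : PP3 n (k + 1) fun x y z =>
    (lev x < k ∧ x = y ∧ y = z) ∨ OddTriple (one k) bot x y z := by
  obtain ⟨ρ, hρ⟩ := exists_lin (n := n) (k := k)
  exact (PPd.sym ρ).congr fun t => (hρ t).symm

theorem exists_perm_of_biunique {α : Type} [Finite α] {N : α → α → Prop}
    (hN : ∀ x y x' y', N x y → N x' y' → (x = x' ↔ y = y')) :
    ∃ σ : Equiv.Perm α, ∀ x y, N x y → σ x = y := by
  classical
  cases nonempty_fintype α
  have hf : ∀ x : {x // ∃ y, N x y}, ∃ y : {y // ∃ x, N x y}, N x.1 y.1 :=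
    fun ⟨x, y, h⟩ => ⟨⟨y, x, h⟩, h⟩
  choose f hf using hf
  have hbij : Function.Bijective f := by
    constructor
    · intro x x' h
      exact Subtype.ext ((hN _ _ _ _ (hf x) (hf x')).2 (congrArg _ h))
    · rintro ⟨y, x, h⟩
      exact ⟨⟨x, y, h⟩, Subtype.ext ((hN _ _ _ _ (hf _) h).1 rfl)⟩
  refine ⟨(Equiv.ofBijective f hbij).extendSubtype, fun x y h => ?_⟩
  rw [Equiv.extendSubtype_apply_of_mem _ _ ⟨y, h⟩]
  exact (hN _ _ _ _ (hf ⟨x, y, h⟩) h).1 rfl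

/-- On each level the partial bijection extends to a permutation of O_n, and the nested symbol
collects one permutation per level. -/
theorem exists_extension {N : P n k → P n k → Prop} (hlev : ∀ x y, N x y → lev x = lev y)
    (hN : ∀ x y x' y', N x y → N x' y' → (x = x' ↔ y = y')) :
    ∃ ρ : PSym n k 2, (∀ t : Fin 2 → P n k, N (t 0) (t 1) → t ∈ ρ.interp) ∧
      ∀ t ∈ ρ.interp, ∀ t' ∈ ρ.interp, t 0 = t' 0 → t 1 = t' 1 := by
  induction k with
  | zero =>
    exact ⟨.eq2, fun t _ => (eq_bot_of_zero _).trans (eq_bot_of_zero _).symm,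
      fun t _ t' _ _ => (eq_bot_of_zero _).trans (eq_bot_of_zero _).symm⟩
  | succ k ih =>
    obtain ⟨ρ, h1, h2⟩ := ih (N := fun x y => N (up x) (up y))
      (fun x y h => by simpa using hlev _ _ h)
      (fun x y x' y' h h' => by simpa using hN _ _ _ _ h h')
    have : Finite (O n) := Finite.of_injective (incl : O n → P n 1) incl_injective
    obtain ⟨σ, hσ⟩ := exists_perm_of_biunique
      (N := fun x y : O n => N (incl x) (incl y))
      (fun x y x' y' h h' => by simpa using hN _ _ _ _ h h')
    refine ⟨.pair ρ (.graph σ), fun t ht => ?_, fun t ht t' ht' e => ?_⟩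
    · rw [mem_pair_two]
      have := hlev _ _ ht
      rcases eq_up_or_eq_incl (t 0) with ⟨a, ha⟩ | ⟨a, ha⟩ <;>
        rcases eq_up_or_eq_incl (t 1) with ⟨b, hb⟩ | ⟨b, hb⟩ <;> rw [ha, hb] at this ht
      · exact Or.inl ⟨a, b, h1 _ ht, ha, hb⟩
      · simp at this
      · simp at this
      · exact Or.inr ⟨a, b, (hσ _ _ ht).symm, ha, hb⟩
    · rw [mem_pair_two] at ht ht'
      rcases ht with ⟨a, b, h, ha, hb⟩ | ⟨a, b, h, ha, hb⟩ <;>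
        rcases ht' with ⟨a', b', h', ha', hb'⟩ | ⟨a', b', h', ha', hb'⟩ <;> rw [ha, ha'] at e <;>
        rw [hb, hb']
      · exact congrArg up (h2 _ h _ h' (up_injective e))
      · exact (up_ne_incl _ _ e).elim
      · exact (incl_ne_up _ _ e).elim
      · obtain rfl := incl_injective e
        have e1 : b = σ a := h
        have e2 : b' = σ a := h'
        rw [e1, e2]

/-- The extending relation is functional, so restricting its first coordinate to the domain of N
gives back N. -/
theorem pp2_of_lev_eq {N : P n k → P n k → Prop} (hlev : ∀ x y, N x y → lev x = lev y)
    (hN : ∀ x y x' y', N x y → N x' y' → (x = x' ↔ y = y')) : PP2 n k N := by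
  obtain ⟨ρ, h1, h2⟩ := exists_extension hlev hN
  have h : PP2 n k fun x y => ![x, y] ∈ ρ.interp := by
    refine (PPd.sym ρ).congr fun t => ?_
    have : ![t 0, t 1] = t := by refine funext ?_; simp [Fin.forall_fin_two]
    simp [this]
  refine (h.and_left (pp1 fun x => ∃ y, N x y)).congr fun x y => ⟨fun hxy => ?_, ?_⟩
  · exact ⟨h1 ![x, y] hxy, y, hxy⟩
  · rintro ⟨hxy, y', hxy'⟩
    have : y = y' := h2 _ hxy _ (h1 ![x, y'] hxy') rfl
    rwa [this]

/-- The transposition of `0^k` and a leaf of the last level is definable. -/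
theorem pp2_swap {y : P n (k + 1)} (hy : k ≤ lev y) :
    PP2 n (k + 1) fun x z => z = Equiv.swap bot y x := by
  by_cases hb : y = bot
  · subst hb
    exact PP2.eq.congr fun x z => by simp [eq_comm]
  have hy' : lev y = k := by
    have := lev_lt_iff.2 hb
    omega
  -- This transposition preserves levels; conjugating the basic transposition by it replaces 0^k 1
  -- by y.
  have hσ : PP2 n (k + 1) fun x z => z = Equiv.swap (one k) y x := by
    refine pp2_of_lev_eq ?_ ?_
    · rintro x _ rfl
      rw [Equiv.swap_apply_def]
      split_ifs with h1 h2
      · rw [h1, hy', lev_one]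
      · rw [h2, hy', lev_one]
      · rfl
    · rintro x _ x' _ rfl rfl
      rw [Equiv.apply_eq_iff_eq]
  refine ((hσ.comp pp2_swap_one).comp hσ).congr fun x z => ?_
  have key : Equiv.swap bot y x = Equiv.swap (one k) y (Equiv.swap bot (one k)
      (Equiv.swap (one k) y x)) := by
    rcases eq_or_ne y (one k) with rfl | h
    · simp
    have h1 : (one k : P n (k + 1)) ≠ bot := one_ne_bot
    simp only [Equiv.swap_apply_def]
    grind
  rw [key]
  simp

end Definability

/-! ### Partial bijections that respect strictly least levels. -/

section PartialIsomorphisms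

variable {n k : ℕ}

/-! ### Graphs of partial isomorphisms are definable -/

/-- Families of leaves whose levels are packed towards the bottom. -/
def Packed {ι : Type} (f : ι → P n (k + 1)) : Prop :=
  (∀ c, lev (f c) < k → ∃ c', lev (f c') = lev (f c) + 1) ∧
    ∀ c, lev (f c) = k → ∃ d, d ≠ c ∧ k ≤ lev (f d)

/-- `f'` is obtained from `f` by a definable injection that preserves the order of levels. -/
def Moves {ι : Type} (f f' : ι → P n (k + 1)) : Prop :=
  (∃ E : P n (k + 1) → P n (k + 1) → Prop, PP2 n (k + 1) E ∧ (∀ c, E (f c) (f' c)) ∧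
    ∀ c x, E x (f' c) → x = f c) ∧ ∀ a b, lev (f a) < lev (f b) ↔ lev (f' a) < lev (f' b)

theorem Moves.refl {ι : Type} (f : ι → P n (k + 1)) : Moves f f :=
  ⟨⟨_, PP2.eq, fun _ => rfl, fun _ _ => id⟩, fun _ _ => Iff.rfl⟩

theorem Moves.trans {ι : Type} {f f' f'' : ι → P n (k + 1)} (h : Moves f f') (h' : Moves f' f'') :
    Moves f f'' := by
  obtain ⟨⟨E, hE, h1, h2⟩, h3⟩ := h
  obtain ⟨⟨E', hE', h1', h2'⟩, h3'⟩ := h'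
  refine ⟨⟨_, hE.comp hE', fun c => ⟨_, h1 c, h1' c⟩, ?_⟩, fun a b => (h3 a b).trans (h3' a b)⟩
  rintro c x ⟨z, hz, hz'⟩
  obtain rfl := h2' c z hz'
  exact h2 c x hz

theorem Moves.injective {ι : Type} {f f' : ι → P n (k + 1)} (h : Moves f f')
    (hf : Function.Injective f) : Function.Injective f' := by
  obtain ⟨⟨E, hE, h1, h2⟩, h3⟩ := h
  intro a b e
  exact hf (h2 b (f a) (e ▸ h1 a))

/-- Two families of leaves with the same strictly least elements of triples. -/
def SameMin {A ι : Type} (lev : A → ℕ) (f g : ι → A) : Prop :=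
  ∀ a b c, a ≠ b → a ≠ c → b ≠ c →
    (lev (f a) < lev (f b) ∧ lev (f a) < lev (f c) ↔ lev (g a) < lev (g b) ∧ lev (g a) < lev (g c))

theorem SameMin.symm {A ι : Type} {lev : A → ℕ} {f g : ι → A} (h : SameMin lev f g) :
    SameMin lev g f :=
  fun a b c h1 h2 h3 => (h a b c h1 h2 h3).symm

/-- Following occupied levels downwards leads to a leaf of level k, and packedness supplies a second
leaf at least as deep. -/
theorem Packed.exists_deep {ι : Type} {f : ι → P n (k + 1)} (hf : Packed f) {c : ι}
    (hc : lev (f c) < k) : ∃ p q, p ≠ q ∧ k ≤ lev (f p) ∧ k ≤ lev (f q) := by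
  induction hm : k - lev (f c) using Nat.strong_induction_on generalizing c with
  | _ m ih =>
    obtain ⟨c', h⟩ := hf.1 c hc
    by_cases hc' : lev (f c') < k
    · exact ih _ (by omega) hc' rfl
    · obtain ⟨p, hp, hp'⟩ := hf.2 c' (by omega)
      exact ⟨p, c', hp, hp', by omega⟩

/-- `SameMin` speaks only about triples; a deep leaf different from that of y serves as the third
element and turns the comparison of x and y into one of strict minima. -/
theorem Packed.lev_lt {ι : Type} {f g : ι → P n (k + 1)} (hf : Packed f)
    (h : SameMin lev f g) {x y : ι} (hx : lev (f x) < k) (hxy : lev (f x) < lev (f y)) :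
    lev (g x) < lev (g y) := by
  obtain ⟨p, q, hpq, hp, hq⟩ := hf.exists_deep hx
  obtain ⟨z, hz, hzy⟩ : ∃ z, k ≤ lev (f z) ∧ z ≠ y := by
    by_cases hpy : p = y
    · exact ⟨q, hq, fun e => hpq (hpy.trans e.symm)⟩
    · exact ⟨p, hp, hpy⟩
  exact ((h x y z (by rintro rfl; omega) (by rintro rfl; omega) hzy.symm).1 ⟨hxy, by omega⟩).1

variable [hn : Fact (2 ≤ n)]

/-- Packedness fails because of an empty level right after an occupied one, or because a leaf of
level k is alone in the last star. Moving a level down, respectively transposing with 0^{k+1},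
reduces the total distance to the deepest level. -/
theorem exists_move {ι : Type} [Fintype ι] {f : ι → P n (k + 1)} (hf : Function.Injective f)
    (h : ¬Packed f) : ∃ f', Moves f f' ∧
      ∑ c, (k + 1 - lev (f' c)) < ∑ c, (k + 1 - lev (f c)) := by
  rw [Packed, not_and_or] at h
  push Not at h
  rcases h with ⟨c, hc, hne⟩ | ⟨c, hc, hlt⟩
  · have hE := pp2_move (n := n) (k := k + 1) (i := lev (f c)) (by omega)
    have hex : ∀ a, ∃ w : P n (k + 1), lev (f a) ≠ lev (f c) + 1 ∧ col w = col (f a) ∧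
        lev w = if lev (f a) = lev (f c) then lev (f c) + 1 else lev (f a) := by
      intro a
      by_cases ha : lev (f a) = lev (f c)
      · obtain ⟨w, h1, h2⟩ := exists_lev_col_of_ne (j := lev (f c) + 1) (f a)
          (lev_lt_iff.1 (by omega)) (by omega)
        exact ⟨w, hne a, h2, by simp [ha, h1]⟩
      · exact ⟨f a, hne a, rfl, by simp [ha]⟩
    choose f' hf' using hex
    refine ⟨f', ⟨⟨_, hE, hf', ?_⟩, ?_⟩, ?_⟩
    · rintro a x ⟨h1, h2, h3⟩
      obtain ⟨h1', h2', h3'⟩ := hf' a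
      refine ext_lev_col ?_ (by rw [← h2, ← h2'])
      grind
    · intro a b
      obtain ⟨h1, -, h3⟩ := hf' a
      obtain ⟨h1', -, h3'⟩ := hf' b
      grind
    · refine Finset.sum_lt_sum (fun a _ => ?_) ⟨c, Finset.mem_univ _, ?_⟩
      · have := (hf' a).2.2
        grind
      · have := (hf' c).2.2
        grind
  · have hbot : ∀ a, a ≠ c → Equiv.swap bot (f c) (f a) = f a := by
      intro a ha
      refine Equiv.swap_apply_of_ne_of_ne (lev_lt_iff.1 ?_) (hf.ne ha)
      have := hlt a ha
      omega
    refine ⟨fun a => Equiv.swap bot (f c) (f a), ⟨⟨_, pp2_swap hc.ge, fun _ => rfl, ?_⟩, ?_⟩, ?_⟩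
    · intro a x e
      exact ((Equiv.apply_eq_iff_eq _).1 e).symm
    · intro a b
      have h1 := hlt a
      have h2 := hlt b
      by_cases ha : a = c <;> by_cases hb : b = c
      · simp [ha, hb]
      · simp only [ha, hbot b hb, Equiv.swap_apply_right, lev_bot]
        have := h2 hb
        omega
      · simp only [hb, hbot a ha, Equiv.swap_apply_right, lev_bot]
        have := h1 ha
        omega
      · simp only [hbot a ha, hbot b hb]
    · refine Finset.sum_lt_sum (fun a _ => ?_) ⟨c, Finset.mem_univ _, ?_⟩
      · by_cases ha : a = c
        · simp [ha]
        · simp [hbot a ha]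
      · simp [hc]

theorem exists_packed {ι : Type} [Fintype ι] (f : ι → P n (k + 1)) (hf : Function.Injective f) :
    ∃ f', Moves f f' ∧ Packed f' := by
  induction hm : ∑ c, (k + 1 - lev (f c)) using Nat.strong_induction_on generalizing f with
  | _ m ih =>
    by_cases h : Packed f
    · exact ⟨f, Moves.refl f, h⟩
    · obtain ⟨f', h1, h2⟩ := exists_move hf h
      obtain ⟨f'', h3, h4⟩ := ih _ (hm ▸ h2) f' (h1.injective hf) rfl
      exact ⟨f'', h1.trans h3, h4⟩

/-- Induction from the deepest levels upwards: the bound for the next occupied level, together with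
`Packed.lev_lt`, gives the bound for x. -/
theorem Packed.lev_le {ι : Type} {f g : ι → P n (k + 1)} (hf : Packed f)
    (hg : Function.Injective g) (h : SameMin lev f g) {x : ι} (hx : lev (f x) < k) :
    lev (g x) ≤ lev (f x) := by
  induction hm : k - lev (f x) using Nat.strong_induction_on generalizing x with
  | _ m ih =>
    obtain ⟨y, hy⟩ := hf.1 x hx
    by_cases hy' : lev (f y) < k
    · have h1 := ih _ (by omega) hy' rfl
      have h2 := hf.lev_lt h hx (y := y) (by omega)
      omega
    -- Here f x has level k - 1. Of two deep indices at least one is not sent to 0^{k+1} by the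
    -- injective g, so its image has level at most k, and g x is strictly less deep.
    · obtain ⟨p, q, hpq, hp, hq⟩ := hf.exists_deep hx
      have h1 := hf.lev_lt h hx (y := p) (by omega)
      have h2 := hf.lev_lt h hx (y := q) (by omega)
      have h3 : lev (g p) ≠ k + 1 ∨ lev (g q) ≠ k + 1 := by
        by_contra! hcon
        exact hpq (hg ((lev_eq_iff.1 hcon.1).trans (lev_eq_iff.1 hcon.2).symm))
      have h4 := ProjTree.lev_le (g p)
      have h5 := ProjTree.lev_le (g q)
      omega

theorem pp2_of_lev_eq_above {ι : Type} {f g : ι → P n (k + 1)} (hf : Function.Injective f)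
    (hg : Function.Injective g) (h : ∀ c, lev (f c) < k → lev (g c) = lev (f c))
    (h' : ∀ c, lev (g c) < k → lev (f c) = lev (g c)) (hbot : ∀ c, f c = bot ↔ g c = bot) :
    PP2 n (k + 1) fun x y => ∃ c, x = f c ∧ y = g c := by
  refine pp2_of_lev_eq ?_ ?_
  · rintro _ _ ⟨c, rfl, rfl⟩
    have h1 := h c
    have h2 := h' c
    have h3 := hbot c
    rw [← lev_eq_iff, ← lev_eq_iff] at h3
    have := lev_le (f c)
    have := lev_le (g c)
    omega
  · rintro _ _ _ _ ⟨c, rfl, rfl⟩ ⟨d, rfl, rfl⟩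
    rw [hf.eq_iff, hg.eq_iff]

/-- Levels can disagree only inside the last star, where 0^{k+1} may correspond to a leaf of level
k. A definable transposition applied to the values of g removes the discrepancy. -/
theorem pp2_of_packed_of_eq_bot {ι : Type} {f g : ι → P n (k + 1)} (hf : Function.Injective f)
    (hg : Function.Injective g) (h : ∀ c, lev (f c) < k → lev (g c) = lev (f c))
    (h' : ∀ c, lev (g c) < k → lev (f c) = lev (g c)) {c₀ : ι} (hc₀ : f c₀ = bot) :
    PP2 n (k + 1) fun x y => ∃ c, x = f c ∧ y = g c := by
  have hk : k ≤ lev (g c₀) := by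
    by_contra! hlt
    have := h' c₀ hlt
    rw [hc₀, lev_bot] at this
    omega
  set σ := Equiv.swap bot (g c₀) with hσ
  have hlev : ∀ c, lev (g c) < k → σ (g c) = g c := by
    intro c hc
    refine Equiv.swap_apply_of_ne_of_ne (lev_lt_iff.1 (by omega)) ?_
    rintro e
    rw [e] at hc
    omega
  have hlev' : ∀ c, k ≤ lev (g c) → k ≤ lev (σ (g c)) := by
    intro c hc
    rw [hσ, Equiv.swap_apply_def]
    split_ifs <;> simp_all
  have hE : PP2 n (k + 1) fun x y => ∃ c, x = f c ∧ y = σ (g c) := by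
    refine pp2_of_lev_eq_above hf (σ.injective.comp hg) (fun c hc => ?_) (fun c hc => ?_)
      fun c => ?_
    · have := h c hc
      rw [hlev c (by omega), this]
    · have h1 : lev (g c) < k := by
        by_contra! hcon
        exact absurd (hlev' c hcon) (not_le.2 hc)
      rw [hlev c h1]
      exact h' c h1
    · rw [← hc₀, hf.eq_iff]
      constructor
      · rintro rfl
        simp [hσ, hc₀]
      · intro e
        rw [hc₀, ← Equiv.swap_apply_right bot (g c₀), ← hσ, σ.apply_eq_iff_eq] at e
        exact hg e
  refine (hE.comp (pp2_swap hk).symm).congr fun x y => ⟨?_, ?_⟩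
  · rintro ⟨c, rfl, rfl⟩
    exact ⟨_, ⟨c, rfl, rfl⟩, rfl⟩
  · rintro ⟨z, ⟨c, rfl, rfl⟩, e⟩
    exact ⟨c, rfl, (σ.injective e).symm⟩

theorem pp2_of_packed {ι : Type} {f g : ι → P n (k + 1)} (hf : Function.Injective f)
    (hg : Function.Injective g) (hpf : Packed f) (hpg : Packed g) (h : SameMin lev f g) :
    PP2 n (k + 1) fun x y => ∃ c, x = f c ∧ y = g c := by
  have h1 : ∀ c, lev (f c) < k → lev (g c) = lev (f c) := by
    intro c hc
    have e1 := hpf.lev_le hg h hc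
    have e2 := hpg.lev_le hf h.symm (x := c) (by omega)
    omega
  have h2 : ∀ c, lev (g c) < k → lev (f c) = lev (g c) := by
    intro c hc
    have e1 := hpg.lev_le hf h.symm hc
    have e2 := hpf.lev_le hg h (x := c) (by omega)
    omega
  by_cases hb : ∃ c, f c = bot
  · obtain ⟨c, hc⟩ := hb
    exact pp2_of_packed_of_eq_bot hf hg h1 h2 hc
  by_cases hb' : ∃ c, g c = bot
  · obtain ⟨c, hc⟩ := hb'
    exact (pp2_of_packed_of_eq_bot hg hf h2 h1 hc).symm.congr fun x y => by simp only [and_comm]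
  · push Not at hb hb'
    exact pp2_of_lev_eq_above hf hg h1 h2 fun c => iff_of_false (hb c) (hb' c)

/-- Both families are moved to packed position, matched there, and moved back. Since a move
determines the preimage of each of its target values, the composite contains no further pairs. -/
theorem pp2_of_sameMin {ι : Type} [Finite ι] {f g : ι → P n (k + 1)} (hf : Function.Injective f)
    (hg : Function.Injective g) (h : SameMin lev f g) :
    PP2 n (k + 1) fun x y => ∃ c, x = f c ∧ y = g c := by
  cases nonempty_fintype ι
  obtain ⟨f', hf', hpf⟩ := exists_packed f hf
  obtain ⟨g', hg', hpg⟩ := exists_packed g hg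
  have key : PP2 n (k + 1) fun x y => ∃ c, x = f' c ∧ y = g' c := by
    refine pp2_of_packed (hf'.injective hf) (hg'.injective hg) hpf hpg fun a b c h1 h2 h3 => ?_
    rw [← hf'.2, ← hf'.2, ← hg'.2, ← hg'.2]
    exact h a b c h1 h2 h3
  obtain ⟨⟨E, hE, hE1, hE2⟩, -⟩ := hf'
  obtain ⟨⟨F, hF, hF1, hF2⟩, -⟩ := hg'
  refine ((hE.comp key).comp hF.symm).congr fun x y => ⟨?_, ?_⟩
  · rintro ⟨c, rfl, rfl⟩
    exact ⟨g' c, ⟨f' c, hE1 c, c, rfl, rfl⟩, hF1 c⟩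
  · rintro ⟨_, ⟨_, h1, c, rfl, rfl⟩, h2⟩
    exact ⟨c, hE2 c x h1, hF2 c y h2⟩

/-- Bijections between sets of leaves that respect strictly least elements of triples have
definable graphs. -/
theorem pp2_of_biunique {N : P n (k + 1) → P n (k + 1) → Prop}
    (hN : ∀ x y x' y', N x y → N x' y' → (x = x' ↔ y = y'))
    (hmin : ∀ x y x' y' x'' y'', N x y → N x' y' → N x'' y'' → x ≠ x' → x ≠ x'' → x' ≠ x'' →
      (lev x < lev x' ∧ lev x < lev x'' ↔ lev y < lev y' ∧ lev y < lev y'')) :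
    PP2 n (k + 1) N := by
  let f : {p : P n (k + 1) × P n (k + 1) // N p.1 p.2} → P n (k + 1) := fun p => p.1.1
  let g : {p : P n (k + 1) × P n (k + 1) // N p.1 p.2} → P n (k + 1) := fun p => p.1.2
  have hf : Function.Injective f := fun a b e =>
    Subtype.ext (Prod.ext e ((hN _ _ _ _ a.2 b.2).1 e))
  have hg : Function.Injective g := fun a b e =>
    Subtype.ext (Prod.ext ((hN _ _ _ _ a.2 b.2).2 e) e)
  refine (pp2_of_sameMin hf hg fun a b c h1 h2 h3 => hmin _ _ _ _ _ _ a.2 b.2 c.2 (hf.ne h1)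
    (hf.ne h2) (hf.ne h3)).congr fun x y => ⟨fun h => ⟨⟨(x, y), h⟩, rfl, rfl⟩, ?_⟩
  rintro ⟨⟨⟨a, b⟩, h⟩, rfl, rfl⟩
  exact h

end PartialIsomorphisms

/-! ### Collapsing deep levels, and the rigidity of critical relations. -/

section CriticalRelations

/-! ### Evaluating the operation -/

section Op

variable {A : Type} [DecidableEq A] {lev : A → ℕ} {a b c : A}

theorem op_min_left (h : lev a < lev b) (h' : lev a < lev c) : op lev a b c = a := by
  unfold op; grind

theorem op_min_mid (h : lev b < lev a) (h' : lev b < lev c) : op lev a b c = b := by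
  unfold op; grind

theorem op_min_right (h : lev c < lev a) (h' : lev c < lev b) : op lev a b c = c := by
  unfold op; grind

theorem op_flat (hab : a ≠ b) (hac : a ≠ c) (hbc : b ≠ c) (h : lev b ≤ lev a ∨ lev c ≤ lev a)
    (h' : lev a ≤ lev c ∨ lev b ≤ lev c) : op lev a b c = b := by
  unfold op; grind

end Op

/-- The coordinatewise operation on tuples. -/
def opT {A V : Type} [DecidableEq A] (lev : A → ℕ) (x y z : V → A) : V → A :=
  fun i => op lev (x i) (y i) (z i)

variable {n k : ℕ} [hn : Fact (2 ≤ n)] {V : Type}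

/-- A collapsed argument stays deeper than all uncollapsed ones, so no strict minimum among the
latter changes, and three deep arguments have a deep value. -/
theorem op_ret {d : ℕ} (hd : d ≤ k) (a b c : P n k) :
    op lev (ret d a) (ret d b) (ret d c) = ret d (op lev a b c) := by
  have h : lev (bot : P n k) = k := lev_bot
  unfold ret
  by_cases ha : d ≤ lev a <;> by_cases hb : d ≤ lev b <;> by_cases hc : d ≤ lev c <;>
    simp only [ha, hb, hc, if_true, if_false, op_left, op_right, op_mid]
  · rw [if_pos]
    unfold op
    split_ifs <;> assumption
  · rw [op_min_right (by omega) (by omega), if_neg hc]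
  · rw [op_min_mid (by omega) (by omega), if_neg hb]
  · unfold op; grind
  · rw [op_min_left (by omega) (by omega), if_neg ha]
  · unfold op; grind
  · unfold op; grind
  · rw [if_neg]
    unfold op
    split_ifs <;> assumption

/-- Tuples that agree with an excluded tuple up to a collapse of the deeper levels are excluded. -/
theorem ret_ne_of_notMem [Finite V] [Nontrivial V] [DecidableEq V] {R : Set (V → P n k)}
    (hR : OpClosed lev R) {t s : V → P n k} (ht : t ∉ R)
    (hs : ∀ i, Function.update t i (s i) ∈ R) {y : V → P n k} (hy : y ∈ R) :
    ¬∀ i, ret (min (lev (t i)) (lev (s i)) + 1) (y i) =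
      ret (min (lev (t i)) (lev (s i)) + 1) (t i) := by
  cases nonempty_fintype V
  intro hret
  induction hm : (Finset.univ.filter fun i => y i ≠ t i).card using Nat.strong_induction_on
    generalizing y with
  | _ m ih =>
    have hne : ∃ i, y i ≠ t i := by
      by_contra! h
      exact ht (funext h ▸ hy)
    obtain ⟨i, hi⟩ := hne
    obtain ⟨h, hh⟩ := exists_ne i
    have hst : ∀ i, s i ≠ t i := by
      intro i e
      have := hs i
      rw [e, Function.update_eq_self] at this
      exact ht this
    -- A disagreement can only occur among collapsed leaves, so there s i is strictly less deep than
    -- both y i and t i.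
    have hlev : ∀ i, y i ≠ t i → lev (s i) < lev (y i) ∧ lev (s i) < lev (t i) := by
      intro i hi
      have h1 := hret i
      have h2 := lev_le (t i)
      have h3 := lev_le (s i)
      have h4 : ¬(lev (t i) = k ∧ lev (s i) = k) := fun e =>
        hst i ((lev_eq_iff.1 e.2).trans (lev_eq_iff.1 e.1).symm)
      have h5 := lev_eq_iff (v := y i)
      have h6 := lev_eq_iff (v := t i)
      unfold ret at h1
      grind
    have o1 : ∀ i, op lev (s i) (y i) (t i) = s i := by
      intro i
      by_cases e : y i = t i
      · rw [e, op_right]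
      · exact op_min_left (hlev i e).1 (hlev i e).2
    have o2 : ∀ i, op lev (t i) (y i) (s i) = s i := by
      intro i
      by_cases e : y i = t i
      · rw [e, op_left]
      · exact op_min_right (hlev i e).2 (hlev i e).1
    -- This composite restores t at i and h and keeps y elsewhere. The disagreement at i disappears
    -- and none is created, so iteration would put t into R.
    have hz := hR _ (hR _ (hs i) _ hy _ (hs h)) _ (hs i) _ (hs h)
    set z : V → P n k := fun g => op lev (op lev (Function.update t i (s i) g) (y g)
      (Function.update t h (s h) g)) (Function.update t i (s i) g) (Function.update t h (s h) g)
      with hzdef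
    have hzi : ∀ g, z g = if g = i ∨ g = h then t g else y g := by
      intro g
      by_cases e1 : g = i
      · subst e1
        simp [hzdef, Function.update_of_ne hh.symm, o1]
      · by_cases e2 : g = h
        · subst e2
          simp [hzdef, Function.update_of_ne e1, o2]
        · simp [hzdef, e1, e2]
    refine ih _ ?_ hz (fun g => ?_) rfl
    · rw [← hm]
      refine Finset.card_lt_card ?_
      rw [Finset.ssubset_iff_of_subset]
      · refine ⟨i, by simp [hi], by simp [hzi]⟩
      · intro g
        simp only [Finset.mem_filter, Finset.mem_univ, true_and, hzi]
        split_ifs <;> simp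
    · rw [hzi]
      split_ifs
      exacts [rfl, hret g]

/-- A relation that omits `t`, contains all the tuples that differ from `t` by `s` in one place,
and does not distinguish levels below the meets of the `t i` and `s i`. -/
structure Critical [DecidableEq V] (R : Set (V → P n k)) (t s : V → P n k) : Prop where
  closed : OpClosed lev R
  notMem : t ∉ R
  mem : ∀ i, Function.update t i (s i) ∈ R
  lev_le : ∀ x ∈ R, ∀ i, lev (x i) ≤ min (lev (t i)) (lev (s i)) ∨ x i = bot

namespace Critical

variable [DecidableEq V] {R : Set (V → P n k)} {t s : V → P n k}

theorem ne (H : Critical R t s) (i : V) : s i ≠ t i := by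
  intro e
  have := H.mem i
  rw [e, Function.update_eq_self] at this
  exact H.notMem this

theorem opT_mem (H : Critical R t s) {x y z : V → P n k} (hx : x ∈ R) (hy : y ∈ R) (hz : z ∈ R) :
    opT lev x y z ∈ R := H.closed x hx y hy z hz

/-- In the minority of p, q and the update of t at h, the first two cancel off h and leave t; at h
the two entries s h cancel and leave t h. This is the main source of contradictions below. -/
theorem false_of_eq (H : Critical R t s) {p q : V → P n k} (hp : p ∈ R) (hq : q ∈ R) {h : V}
    (heq : ∀ g, g ≠ h → p g = q g) (hph : p h = t h) (hqh : q h = s h) : False := by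
  refine H.notMem ?_
  convert H.opT_mem hp hq (H.mem h) using 1
  funext g
  by_cases e : g = h
  · subst e
    simp [opT, hph, hqh]
  · simp [opT, heq g e, Function.update_of_ne e]

theorem min_lt (H : Critical R t s) (i : V) : min (lev (t i)) (lev (s i)) < k := by
  have h2 := ProjTree.lev_le (t i)
  have h3 := ProjTree.lev_le (s i)
  have h4 : ¬(lev (t i) = k ∧ lev (s i) = k) := fun e =>
    H.ne i ((lev_eq_iff.1 e.2).trans (lev_eq_iff.1 e.1).symm)
  omega

theorem lev_left [Nontrivial V] (H : Critical R t s) (i : V) :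
    lev (t i) ≤ min (lev (t i)) (lev (s i)) ∨ t i = bot := by
  obtain ⟨h, hh⟩ := exists_ne i
  simpa [Function.update_of_ne hh.symm] using H.lev_le _ (H.mem h) i

theorem lev_right (H : Critical R t s) (i : V) :
    lev (s i) ≤ min (lev (t i)) (lev (s i)) ∨ s i = bot := by
  simpa using H.lev_le _ (H.mem i) i

/-- On the deepest class the operation is the second projection at injective triples. -/
theorem op_deep (H : Critical R t s) (i : V) {a b c : P n k}
    (ha : lev a ≤ min (lev (t i)) (lev (s i)) ∨ a = bot)
    (ha' : min (lev (t i)) (lev (s i)) ≤ lev a)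
    (hb : lev b ≤ min (lev (t i)) (lev (s i)) ∨ b = bot)
    (hb' : min (lev (t i)) (lev (s i)) ≤ lev b)
    (hc : lev c ≤ min (lev (t i)) (lev (s i)) ∨ c = bot)
    (hc' : min (lev (t i)) (lev (s i)) ≤ lev c) (hab : a ≠ b) (hac : a ≠ c) (hbc : b ≠ c) :
    op lev a b c = b := by
  have hk := H.min_lt i
  generalize min (lev (t i)) (lev (s i)) = j at *
  have hbot : lev (bot : P n k) = k := lev_bot
  refine op_flat hab hac hbc ?_ ?_ <;> grind

theorem op_left_right [Nontrivial V] (H : Critical R t s) (i : V) {a : P n k}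
    (ha : lev a ≤ min (lev (t i)) (lev (s i)) ∨ a = bot)
    (ha' : min (lev (t i)) (lev (s i)) ≤ lev a) (hat : a ≠ t i) (has : a ≠ s i) :
    op lev a (t i) (s i) = t i ∧ op lev a (s i) (t i) = s i :=
  ⟨H.op_deep i ha ha' (H.lev_left i) (min_le_left _ _) (H.lev_right i) (min_le_right _ _) hat has
    (H.ne i).symm,
  H.op_deep i ha ha' (H.lev_right i) (min_le_right _ _) (H.lev_left i) (min_le_left _ _) has hat
    (H.ne i)⟩

/-- If x were shallow at i and deep at h, combining x with the updates at i and h, in either order,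
would change x at most at h. Among x and the two results, two would then take the values t h and s h
there. -/
theorem lev_lt_of_lev_lt [Nontrivial V] (H : Critical R t s) {x : V → P n k} (hx : x ∈ R) {i h : V}
    (hi : lev (x i) < min (lev (t i)) (lev (s i))) :
    lev (x h) < min (lev (t h)) (lev (s h)) := by
  by_contra! hh
  have hih : i ≠ h := by
    rintro rfl
    omega
  have ha := H.opT_mem hx (H.mem i) (H.mem h)
  have hb := H.opT_mem hx (H.mem h) (H.mem i)
  have hag : ∀ g, g ≠ h →
      opT lev x (Function.update t i (s i)) (Function.update t h (s h)) g = x g := by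
    intro g hg
    by_cases e : g = i
    · subst e
      simp only [opT, Function.update_self, Function.update_of_ne hg]
      exact op_min_left (by omega) (by omega)
    · simp [opT, Function.update_of_ne e, Function.update_of_ne hg]
  have hbg : ∀ g, g ≠ h →
      opT lev x (Function.update t h (s h)) (Function.update t i (s i)) g = x g := by
    intro g hg
    by_cases e : g = i
    · subst e
      simp only [opT, Function.update_self, Function.update_of_ne hg]
      exact op_min_left (by omega) (by omega)
    · simp [opT, Function.update_of_ne e, Function.update_of_ne hg]
  have hah : opT lev x (Function.update t i (s i)) (Function.update t h (s h)) h =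
      op lev (x h) (t h) (s h) := by simp [opT, Function.update_of_ne hih.symm]
  have hbh : opT lev x (Function.update t h (s h)) (Function.update t i (s i)) h =
      op lev (x h) (s h) (t h) := by simp [opT, Function.update_of_ne hih.symm]
  by_cases e1 : x h = t h
  · exact H.false_of_eq hx ha (fun g hg => (hag g hg).symm) e1 (by rw [hah, e1, op_left])
  by_cases e2 : x h = s h
  · exact H.false_of_eq ha hx hag (by rw [hah, e2, op_mid]) e2
  obtain ⟨h1, h2⟩ := H.op_left_right h (H.lev_le x hx h) hh e1 e2
  exact H.false_of_eq ha hb (fun g hg => (hag g hg).trans (hbg g hg).symm) (hah.trans h1)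
    (hbh.trans h2)

/-- If x and y agreed at i but not at h, their combination with the update at h would be the deep t
i at i, yet shallow at h. -/
theorem eq_of_eq [Nontrivial V] (H : Critical R t s) {x y : V → P n k} (hx : x ∈ R) (hy : y ∈ R)
    {i h : V} (hi : lev (x i) < min (lev (t i)) (lev (s i))) (hxy : x i = y i) : x h = y h := by
  by_contra hne
  have hih : i ≠ h := by
    rintro rfl
    exact hne hxy
  have h1 := H.lev_lt_of_lev_lt hx (h := h) hi
  have h2 := H.lev_lt_of_lev_lt hy (h := h) (hxy ▸ hi)
  have hw := H.opT_mem hx hy (H.mem h)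
  have hwi : opT lev x y (Function.update t h (s h)) i = t i := by
    simp [opT, hxy, Function.update_of_ne hih]
  have hwh : opT lev x y (Function.update t h (s h)) h = op lev (x h) (y h) (s h) := by
    simp [opT]
  have hlt : lev (op lev (x h) (y h) (s h)) < min (lev (t h)) (lev (s h)) := by
    unfold op
    split_ifs <;> omega
  have := H.lev_lt_of_lev_lt hw (h := i) (hwh ▸ hlt)
  rw [hwi] at this
  omega

/-- Combining x, the update at i and y reproduces x at i, hence also at h by `eq_of_eq`. There the
middle argument is the deep t h, so x h is returned only if it is strictly least. -/
theorem lev_lt_lev [Nontrivial V] (H : Critical R t s) {x y : V → P n k} (hx : x ∈ R) (hy : y ∈ R)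
    {i h : V} (hxi : lev (x i) < min (lev (t i)) (lev (s i)))
    (hyi : lev (y i) < min (lev (t i)) (lev (s i))) (hlt : lev (x i) < lev (y i)) :
    lev (x h) < lev (y h) := by
  by_cases hih : h = i
  · rwa [hih]
  have hxh := H.lev_lt_of_lev_lt hx (h := h) hxi
  have hyh := H.lev_lt_of_lev_lt hy (h := h) hyi
  have hw := H.opT_mem hx (H.mem i) hy
  have hwi : opT lev x (Function.update t i (s i)) y i = x i := by
    simp only [opT, Function.update_self]
    exact op_min_left (by omega) hlt
  have hwh : opT lev x (Function.update t i (s i)) y h = op lev (x h) (t h) (y h) := by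
    simp [opT, Function.update_of_ne hih]
  have e := H.eq_of_eq hx hw (h := h) hxi hwi.symm
  rw [hwh] at e
  have hne : x h ≠ y h := by
    intro e'
    have := H.eq_of_eq hx hy (h := i) hxh e'
    rw [this] at hlt
    omega
  by_contra! hle
  rcases hle.lt_or_eq with h1 | h1
  · rw [op_min_right h1 (by omega)] at e
    exact hne e
  · have h2 : x h ≠ t h := by
      intro e'
      rw [e'] at hxh
      omega
    rw [op_flat h2 hne (by intro e'; rw [← e'] at hyh; omega) (by omega) (by omega)] at e
    exact h2 e

/-- For deep values, a violation yields a tuple of R with value s i at i and a value other than t h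
at h; combining it with the two updates produces t, which is excluded. -/
theorem eq_of_eq_of_pair [Nontrivial V] (H : Critical R t s) {i h : V} (hih : i ≠ h)
    (hV : ∀ g, g = i ∨ g = h) {x y : V → P n k} (hx : x ∈ R) (hy : y ∈ R) (hxy : x i = y i) :
    x h = y h := by
  by_cases hi : lev (x i) < min (lev (t i)) (lev (s i))
  · exact H.eq_of_eq hx hy hi hxy
  have deep : ∀ z ∈ R, ¬lev (z i) < min (lev (t i)) (lev (s i)) →
      min (lev (t h)) (lev (s h)) ≤ lev (z h) := fun z hz hzi => by
    by_contra! hlt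
    exact hzi (H.lev_lt_of_lev_lt hz hlt)
  by_contra hne
  have hxh := deep x hx hi
  have hyh := deep y hy (hxy ▸ hi)
  have hz := H.opT_mem hx hy (H.mem i)
  set z := opT lev x y (Function.update t i (s i)) with hzdef
  have hzi : z i = s i := by simp [hzdef, opT, hxy]
  have hzh : z h = op lev (x h) (y h) (t h) := by
    simp [hzdef, opT, Function.update_of_ne hih.symm]
  have hzt : z h ≠ t h := by
    rw [hzh]
    by_cases e1 : x h = t h
    · rw [e1, op_mid, ← e1]
      exact Ne.symm hne
    by_cases e2 : y h = t h
    · rw [e2, op_right]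
      exact e1
    rw [H.op_deep h (H.lev_le x hx h) hxh (H.lev_le y hy h) hyh (H.lev_left h) (min_le_left _ _) hne
      e1 e2]
    exact e2
  have hzd := deep z hz (by rw [hzi]; omega)
  have tuple : ∀ w ∈ R, w i = t i → w h ≠ t h := by
    intro w hw h1 h2
    refine H.notMem ?_
    convert hw using 1
    funext g
    rcases hV g with rfl | rfl
    exacts [h1.symm, h2.symm]
  have hw := H.opT_mem (H.mem i) hz (H.mem h)
  set w := opT lev (Function.update t i (s i)) z (Function.update t h (s h)) with hwdef
  have hwi : w i = t i := by simp [hwdef, opT, hzi, Function.update_of_ne hih]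
  have hwh : w h = op lev (t h) (z h) (s h) := by
    simp [hwdef, opT, Function.update_of_ne hih.symm]
  by_cases e : z h = s h
  · exact tuple w hw hwi (by rw [hwh, e, op_right])
  · rw [H.op_deep h (H.lev_left h) (min_le_left _ _) (H.lev_le z hz h) hzd (H.lev_right h)
      (min_le_right _ _) hzt.symm (H.ne h).symm e] at hwh
    refine tuple _ (H.opT_mem hw hz (H.mem i)) ?_ ?_
    · simp [opT, hwi, hzi]
    · simp [opT, hwh, Function.update_of_ne hih.symm]

/-- Critical binary relations are definable. -/
theorem ppd_of_pair {R : Set (V → P n (k + 1))} {t s : V → P n (k + 1)} [Nontrivial V]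
    (H : Critical R t s) {i h : V} (hih : i ≠ h) (hV : ∀ g, g = i ∨ g = h) : PPd R := by
  have h1 : ∀ x ∈ R, ∀ y ∈ R, (x i = y i ↔ x h = y h) := fun x hx y hy =>
    ⟨H.eq_of_eq_of_pair hih hV hx hy,
      H.eq_of_eq_of_pair hih.symm (fun g => (hV g).symm) hx hy⟩
  have ext : ∀ x y : V → P n (k + 1), x i = y i → x h = y h → x = y := by
    intro x y e1 e2
    funext g
    rcases hV g with rfl | rfl <;> assumption
  have hN : PP2 n (k + 1) fun a b => ∃ x ∈ R, x i = a ∧ x h = b := by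
    refine pp2_of_biunique ?_ ?_
    · rintro _ _ _ _ ⟨x, hx, rfl, rfl⟩ ⟨y, hy, rfl, rfl⟩
      exact h1 x hx y hy
    · rintro _ _ _ _ _ _ ⟨x, hx, rfl, rfl⟩ ⟨y, hy, rfl, rfl⟩ ⟨z, hz, rfl, rfl⟩ hxy hxz hyz
      have hw := H.opT_mem hx hy hz
      have hxy' : x h ≠ y h := fun e => hxy ((h1 x hx y hy).2 e)
      have hxz' : x h ≠ z h := fun e => hxz ((h1 x hx z hz).2 e)
      have hyz' : y h ≠ z h := fun e => hyz ((h1 y hy z hz).2 e)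
      -- On distinct arguments, being strictly least in first place is the equation `op lev a b c =
      -- a`; it transfers between the coordinates because each coordinate determines the tuple.
      have aux : ∀ a b c : P n (k + 1), a ≠ b → a ≠ c → b ≠ c →
          (lev a < lev b ∧ lev a < lev c ↔ op lev a b c = a) := by
        intro a b c _ _ _
        unfold op
        grind
      rw [aux _ _ _ hxy hxz hyz, aux _ _ _ hxy' hxz' hyz']
      exact h1 _ hw _ hx
  refine (hN.app i h).congr fun x => ⟨fun hx => ⟨x, hx, rfl, rfl⟩, ?_⟩
  rintro ⟨y, hy, e1, e2⟩
  rwa [← ext y x e1 e2]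

/-- A deep tuple outside the box of values s, t at h is outside at every g: otherwise the two orders
of combining it with the updates at g and h agree off h and give t h and s h. With a third
coordinate r, one such combination returns to the box at h but not at r. -/
theorem eq_or_eq [Nontrivial V] (H : Critical R t s) (h3 : ∀ i h : V, ∃ g, g ≠ i ∧ g ≠ h)
    {x : V → P n k} (hx : x ∈ R) {h : V} (hh : min (lev (t h)) (lev (s h)) ≤ lev (x h)) :
    x h = s h ∨ x h = t h := by
  have deep : ∀ x ∈ R, ∀ h, min (lev (t h)) (lev (s h)) ≤ lev (x h) → ∀ g,
      min (lev (t g)) (lev (s g)) ≤ lev (x g) := fun x hx h hh g => by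
    by_contra! hlt
    exact absurd (H.lev_lt_of_lev_lt hx (h := h) hlt) (not_lt.2 hh)
  have other : ∀ (x : V → P n k) (g h : V), g ≠ h → (x ∈ R) →
      min (lev (t h)) (lev (s h)) ≤ lev (x h) → x h ≠ s h → x h ≠ t h →
      x g ≠ s g ∧ x g ≠ t g := by
    intro x g h hgh hx hh hs ht
    obtain ⟨o1, o2⟩ := H.op_left_right h (H.lev_le x hx h) hh ht hs
    by_contra hcon
    refine H.false_of_eq (H.opT_mem hx (H.mem g) (H.mem h)) (H.opT_mem hx (H.mem h) (H.mem g))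
      (h := h) (fun r hr => ?_) ?_ ?_
    · by_cases hrg : r = g
      · subst hrg
        simp only [opT, Function.update_self, Function.update_of_ne hgh]
        rcases not_and_or.1 hcon with e | e
        · rw [not_not.1 e]; simp
        · rw [not_not.1 e]; simp
      · simp [opT, Function.update_of_ne hrg, Function.update_of_ne hr]
    · simpa [opT, Function.update_of_ne hgh.symm] using o1
    · simpa [opT, Function.update_of_ne hgh.symm] using o2
  by_contra hcon
  obtain ⟨hs, ht⟩ := not_or.1 hcon
  obtain ⟨g, hgh⟩ := exists_ne h
  obtain ⟨r, hrh, hrg⟩ := h3 h g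
  obtain ⟨o1, -⟩ := H.op_left_right h (H.lev_le x hx h) hh ht hs
  obtain ⟨hrs, hrt⟩ := other x r h hrh hx hh hs ht
  have hy := H.opT_mem hx (H.mem g) (H.mem h)
  have hyr : opT lev x (Function.update t g (s g)) (Function.update t h (s h)) r = x r := by
    simp [opT, Function.update_of_ne hrh, Function.update_of_ne hrg]
  have hyh : opT lev x (Function.update t g (s g)) (Function.update t h (s h)) h = t h := by
    simpa [opT, Function.update_of_ne hgh.symm] using o1
  refine (other _ h r hrh.symm hy ?_ ?_ ?_).2 hyh
  · rw [hyr]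
    exact deep x hx h hh r
  · rwa [hyr]
  · rwa [hyr]

/-- Combining with the updates at two coordinates of I resets both to t, and the same combination
undoes this. So only the parity of I matters, and it is decided by t itself and its single updates.
-/
theorem piecewise_mem_iff (H : Critical R t s) (I : Finset V) :
    I.piecewise s t ∈ R ↔ Odd I.card := by
  induction hm : I.card using Nat.strong_induction_on generalizing I with
  | _ m ih =>
    rcases Nat.lt_or_ge 1 I.card with h1 | h1
    · obtain ⟨i, hi, h, hh, hih⟩ := Finset.one_lt_card.1 h1
      have hcard : ((I.erase i).erase h).card + 2 = I.card := by
        rw [Finset.card_erase_of_mem (Finset.mem_erase.2 ⟨hih.symm, hh⟩),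
          Finset.card_erase_of_mem hi]
        omega
      have e1 : opT lev (I.piecewise s t) (Function.update t i (s i)) (Function.update t h (s h)) =
          ((I.erase i).erase h).piecewise s t := by
        funext g
        by_cases ei : g = i
        · subst ei
          simp [opT, hi, Function.update_of_ne hih]
        by_cases eh : g = h
        · subst eh
          simp [opT, hh, Function.update_of_ne hih.symm]
        by_cases eI : g ∈ I <;>
          simp [opT, Finset.piecewise, eI, ei, eh]
      have e2 : opT lev (((I.erase i).erase h).piecewise s t) (Function.update t i (s i))
          (Function.update t h (s h)) = I.piecewise s t := by
        funext g
        by_cases ei : g = i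
        · subst ei
          simp [opT, hi, Function.update_of_ne hih]
        by_cases eh : g = h
        · subst eh
          simp [opT, hh, Function.update_of_ne hih.symm]
        by_cases eI : g ∈ I <;>
          simp [opT, Finset.piecewise, eI, ei, eh]
      have h2 : I.piecewise s t ∈ R ↔ ((I.erase i).erase h).piecewise s t ∈ R :=
        ⟨fun hI => e1 ▸ H.opT_mem hI (H.mem i) (H.mem h),
          fun hI => e2 ▸ H.opT_mem hI (H.mem i) (H.mem h)⟩
      rw [h2, ih _ (by omega) _ rfl, ← hm, ← hcard]
      simp [Nat.odd_add]
    · rcases Nat.le_one_iff_eq_zero_or_eq_one.1 h1 with h0 | h0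
      · rw [Finset.card_eq_zero] at h0
        subst h0
        subst hm
        simpa using H.notMem
      · obtain ⟨i, rfl⟩ := Finset.card_eq_one.1 h0
        subst hm
        simpa [Finset.piecewise_singleton] using H.mem i

end Critical

end CriticalRelations

/-! ### Parity relations, definability of critical relations, and separation. -/

section Separation

variable {n k : ℕ} [hn : Fact (2 ≤ n)] {V : Type}

/-! ### Parity relations -/

/-- Either `z = a = b` lies above the last level, or `b` is the sum of `z` and `a` on the
two-element set `{0^k 1, 0^{k+1}}`. -/
def SumTriple (z a b : P n (k + 1)) : Prop :=
  (lev z < k ∧ z = a ∧ a = b) ∨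
    ((z = one k ∨ z = bot) ∧ (a = one k ∨ a = bot) ∧ (b = one k ∨ b = bot) ∧
      (b = one k ↔ (z = one k ↔ a ≠ one k)))

/-- With 0^k 1 read as 1 and 0^{k+1} as 0, the odd parity relation yields u = z + a + 1, and the
transposition turns u into z + a. -/
theorem pp3_sumTriple : PP3 n (k + 1) SumTriple := by
  have h := (pp3_lin (n := n) (k := k)).app (some (0 : Fin 3)) (some 1) none
  have h' := (pp2_swap_one (n := n) (k := k)).app none (some (2 : Fin 3))
  refine (h.and h').exists_one.congr fun t => ?_
  have h1 : (one k : P n (k + 1)) ≠ bot := one_ne_bot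
  have hl : lev (one k : P n (k + 1)) = k := lev_one
  have hl' : lev (bot : P n (k + 1)) = k + 1 := lev_bot
  change SumTriple (t 0) (t 1) (t 2) ↔ ∃ u, ((lev (t 0) < k ∧ t 0 = t 1 ∧ t 1 = u) ∨
    OddTriple (one k) bot (t 0) (t 1) u) ∧ t 2 = Equiv.swap bot (one k) u
  generalize t 0 = z, t 1 = a, t 2 = b
  constructor
  · rintro (⟨h, rfl, rfl⟩ | ⟨hz, ha, hb, h⟩)
    · refine ⟨z, Or.inl ⟨h, rfl, rfl⟩, ?_⟩
      rw [Equiv.swap_apply_of_ne_of_ne] <;> (rintro rfl; omega)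
    · refine ⟨Equiv.swap bot (one k) b, Or.inr ?_, by simp⟩
      rcases hz with rfl | rfl <;> rcases ha with rfl | rfl <;> rcases hb with rfl | rfl <;>
        simp [h1, h1.symm, OddTriple] at h ⊢
  · rintro ⟨u, ⟨h, rfl, rfl⟩ | h, rfl⟩
    · left
      rw [Equiv.swap_apply_of_ne_of_ne]
      · exact ⟨h, rfl, rfl⟩
      all_goals rintro rfl; omega
    · right
      rcases h with ⟨rfl, rfl, rfl⟩ | ⟨rfl, rfl, rfl⟩ | ⟨rfl, rfl, rfl⟩ | ⟨rfl, rfl, rfl⟩ <;>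
        simp [h1, h1.symm]

open Classical in
/-- The coordinates in `I` and the additional coordinate agree above the last level, or they lie
in `{0^k 1, 0^{k+1}}` and the additional coordinate is the sum of those in `I`. -/
def SumRel (I : Finset V) (b : P n (k + 1)) (y : V → P n (k + 1)) : Prop :=
  (lev b < k ∧ ∀ i ∈ I, y i = b) ∨
    ((b = one k ∨ b = bot) ∧ (∀ i ∈ I, y i = one k ∨ y i = bot) ∧
      (b = one k ↔ Odd (∑ i ∈ I, if y i = one k then 1 else 0)))

-- The witness z is the running sum over I, so long parity conditions reduce to ternary ones.
open Classical in
theorem sumRel_insert {I : Finset V} {a : V} (ha : a ∉ I) (b : P n (k + 1))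
    (y : V → P n (k + 1)) :
    SumRel (insert a I) b y ↔ ∃ z, SumRel I z y ∧ SumTriple z (y a) b := by
  have h1 : (one k : P n (k + 1)) ≠ bot := one_ne_bot
  have hl : lev (one k : P n (k + 1)) = k := lev_one
  have hl' : lev (bot : P n (k + 1)) = k + 1 := lev_bot
  simp only [SumRel, SumTriple, Finset.forall_mem_insert, Finset.sum_insert ha]
  generalize (∑ i ∈ I, if y i = one k then 1 else 0) = N
  constructor
  · rintro (⟨hb, hya, hy⟩ | ⟨hb, ⟨hya, hy⟩, h⟩)
    · exact ⟨b, Or.inl ⟨hb, hy⟩, Or.inl ⟨hb, hya.symm, hya⟩⟩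
    · by_cases ho : Odd N
      · refine ⟨one k, Or.inr ⟨Or.inl rfl, hy, by simp [ho]⟩, Or.inr ⟨Or.inl rfl, hya, hb, ?_⟩⟩
        rw [h, Nat.odd_add]
        rcases hya with e | e <;> simp [e, h1.symm, ← Nat.not_odd_iff_even, ho]
      · refine ⟨bot, Or.inr ⟨Or.inr rfl, hy, by simp [ho, h1.symm]⟩,
          Or.inr ⟨Or.inr rfl, hya, hb, ?_⟩⟩
        rw [h, Nat.odd_add]
        rcases hya with e | e <;> simp [e, h1.symm, ← Nat.not_odd_iff_even, ho]
  · rintro ⟨z, ⟨hz, hy⟩ | ⟨hz, hy, hzo⟩, ⟨hz', e1, e2⟩ | ⟨hz', hya, hb, h⟩⟩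
    · subst e2
      subst e1
      exact Or.inl ⟨hz, rfl, hy⟩
    · rcases hz' with rfl | rfl <;> omega
    · rcases hz with rfl | rfl <;> omega
    · refine Or.inr ⟨hb, ⟨hya, hy⟩, ?_⟩
      rw [h, hzo, Nat.odd_add]
      rcases hya with e | e <;> simp [e, h1.symm, ← Nat.not_odd_iff_even]

theorem ppd_sumRel (I : Finset V) :
    PPd {y : Option V → P n (k + 1) | SumRel I (y none) fun i => y (some i)} := by
  classical
  induction I using Finset.induction_on with
  | empty =>
    refine ((pp1 fun b : P n (k + 1) => lev b < k ∨ b = bot).app none).congr fun y => ?_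
    have h1 : (one k : P n (k + 1)) ≠ bot := one_ne_bot
    simp only [SumRel, Set.mem_ofPred_eq]
    refine or_congr (by simp) ?_
    constructor
    · rintro ⟨e | e, -, h⟩
      · simp [e] at h
      · exact e
    · intro e
      simp [e, h1.symm]
  | insert a I ha ih =>
    have e1 := ih.comap fun o : Option V => o.elim (none : Option (Option V)) fun i => some (some i)
    have e2 := (pp3_sumTriple (n := n) (k := k)).app (none : Option (Option V)) (some (some a))
      (some none)
    refine (e1.and e2).exists_one.congr fun y => ?_
    exact sumRel_insert ha _ _

/-- The odd parity relation on `{0^k 1, 0^{k+1}}`, together with the constant tuples above the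
last level. -/
theorem ppd_parity [Fintype V] : PPd {y : V → P n (k + 1) |
    ∃ b, SumRel Finset.univ b y ∧ (lev b < k ∨ b = one k)} :=
  ((ppd_sumRel Finset.univ).and
    ((pp1 fun b : P n (k + 1) => lev b < k ∨ b = one k).app none)).exists_one

/-! ### Separating a tuple from an invariant relation -/

namespace Critical

variable [DecidableEq V] {R : Set (V → P n (k + 1))} {t s : V → P n (k + 1)}

/-- The correspondence between the coordinates `o` and `i` of a critical relation, with the
deepest class at `o` replaced by the standard one. -/
def Link (R : Set (V → P n (k + 1))) (t s : V → P n (k + 1)) (o i : V) (a b : P n (k + 1)) : Prop :=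
  (∃ x ∈ R, lev (x o) < min (lev (t o)) (lev (s o)) ∧ a = x o ∧ b = x i) ∨
    (a = one k ∧ b = s i) ∨ (a = bot ∧ b = t i)

/-- Shallow pairs are matched compatibly with the order of levels. There are only two deep pairs, so
among three distinct pairs a deep one is strictly least on neither side. -/
theorem pp2_link [Nontrivial V] (H : Critical R t s) (o i : V) :
    PP2 n (k + 1) (Link R t s o i) := by
  have h1 : (one k : P n (k + 1)) ≠ bot := one_ne_bot
  have hl : lev (one k : P n (k + 1)) = k := lev_one
  have hl' : lev (bot : P n (k + 1)) = k + 1 := lev_bot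
  have hst := H.ne i
  have hmin := H.min_lt o
  have hcls : ∀ a b, Link R t s o i a b →
      (lev a < k ∧ lev b < min (lev (t i)) (lev (s i)) ∧
        ∃ x ∈ R, lev (x o) < min (lev (t o)) (lev (s o)) ∧ a = x o ∧ b = x i) ∨
      (k ≤ lev a ∧ min (lev (t i)) (lev (s i)) ≤ lev b ∧
        ((a = one k ∧ b = s i) ∨ (a = bot ∧ b = t i))) := by
    rintro a b (⟨x, hx, h, rfl, rfl⟩ | ⟨rfl, rfl⟩ | ⟨rfl, rfl⟩)
    · exact Or.inl ⟨by omega, H.lev_lt_of_lev_lt hx h, x, hx, h, rfl, rfl⟩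
    · exact Or.inr ⟨by omega, by omega, Or.inl ⟨rfl, rfl⟩⟩
    · exact Or.inr ⟨by omega, by omega, Or.inr ⟨rfl, rfl⟩⟩
  have hlt : ∀ a b a' b', Link R t s o i a b → Link R t s o i a' b' → lev a < k →
      (lev a < lev a' ↔ lev b < lev b') := by
    intro a b a' b' h h' hk
    rcases hcls a b h with ⟨-, hb, x, hx, hxo, rfl, rfl⟩ | ⟨hk', -⟩
    · rcases hcls a' b' h' with ⟨-, hb', y, hy, hyo, rfl, rfl⟩ | ⟨hk', hb', -⟩
      · exact ⟨H.lev_lt_lev hx hy hxo hyo, H.lev_lt_lev hx hy hb hb'⟩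
      · exact iff_of_true (by omega) (by omega)
    · omega
  refine pp2_of_biunique ?_ ?_
  · intro a b a' b' h h'
    rcases hcls a b h with ⟨hk, hb, x, hx, hxo, rfl, rfl⟩ | ⟨hk, hb, h⟩ <;>
      rcases hcls a' b' h' with ⟨hk', hb', y, hy, hyo, rfl, rfl⟩ | ⟨hk', hb', h'⟩
    · exact ⟨H.eq_of_eq hx hy hxo, H.eq_of_eq hx hy hb⟩
    · exact iff_of_false (by intro e; rw [e] at hk; omega) (by intro e; rw [e] at hb; omega)
    · exact iff_of_false (by intro e; rw [e] at hk; omega) (by intro e; rw [e] at hb; omega)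
    · rcases h with ⟨rfl, rfl⟩ | ⟨rfl, rfl⟩ <;> rcases h' with ⟨rfl, rfl⟩ | ⟨rfl, rfl⟩ <;>
        simp [h1, h1.symm, hst, hst.symm]
  · intro a b a' b' a'' b'' h h' h'' n1 n2 n3
    by_cases hk : lev a < k
    · rw [hlt a b a' b' h h' hk, hlt a b a'' b'' h h'' hk]
    · have c := hcls a b h
      have c' := hcls a' b' h'
      have c'' := hcls a'' b'' h''
      refine iff_of_false ?_ ?_
      · grind
      · grind

open Classical in
/-- Critical relations of arity at least three are definable. -/
theorem ppd_of_three [Fintype V] [Nontrivial V] (H : Critical R t s)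
    (h3 : ∀ i h : V, ∃ g, g ≠ i ∧ g ≠ h) : PPd R := by
  have h1 : (one k : P n (k + 1)) ≠ bot := one_ne_bot
  have hl : lev (one k : P n (k + 1)) = k := lev_one
  have hl' : lev (bot : P n (k + 1)) = k + 1 := lev_bot
  obtain ⟨o⟩ : Nonempty V := inferInstance
  have hmin := H.min_lt o
  -- The variables `Sum.inl` carry x and the variables `Sum.inr` a tuple y of the parity relation
  -- linked to x coordinatewise. Constant shallow y encode the shallow tuples of R, the others the
  -- odd choices from s and t.
  have hp := (ppd_parity (n := n) (k := k) (V := V)).comap (Sum.inr : V → V ⊕ V)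
  have hL := PPd.forall fun i => (H.pp2_link o i).app (Sum.inr i : V ⊕ V) (Sum.inl i)
  refine (hp.and hL).exists.congr fun x => ?_
  change x ∈ R ↔ ∃ y : V → P n (k + 1), (∃ b, SumRel Finset.univ b y ∧ (lev b < k ∨ b = one k)) ∧
    ∀ i, Link R t s o i (y i) (x i)
  constructor
  · intro hx
    by_cases hxo : lev (x o) < min (lev (t o)) (lev (s o))
    · refine ⟨fun _ => x o, ⟨x o, Or.inl ⟨by omega, fun _ _ => rfl⟩, Or.inl (by omega)⟩,
        fun i => Or.inl ⟨x, hx, hxo, rfl, rfl⟩⟩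
    · have hbox : ∀ i, x i = s i ∨ x i = t i := fun i => H.eq_or_eq h3 hx (by
        by_contra! hlt
        exact hxo (H.lev_lt_of_lev_lt hx hlt))
      have hxI : x = (Finset.univ.filter fun i => x i = s i).piecewise s t := by
        funext i
        rcases hbox i with e | e
        · simp [Finset.piecewise, e]
        · simp [Finset.piecewise, e, (H.ne i).symm]
      have ho := (H.piecewise_mem_iff _).1 (hxI ▸ hx)
      refine ⟨fun i => if x i = s i then one k else bot, ⟨one k, Or.inr ⟨Or.inl rfl, ?_, ?_⟩,
        Or.inr rfl⟩, fun i => ?_⟩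
      · intro i _
        dsimp only
        split_ifs <;> simp
      · rw [Finset.card_filter] at ho
        have hiff : ∀ i, (if x i = s i then one k else bot) = (one k : P n (k + 1)) ↔
            x i = s i := by
          intro i
          split_ifs with e <;> simp [e, h1.symm]
        simpa only [hiff, true_iff] using ho
      · rcases hbox i with e | e
        · exact Or.inr (Or.inl ⟨by simp [e], e⟩)
        · exact Or.inr (Or.inr ⟨by simp [e, (H.ne i).symm], e⟩)
  · rintro ⟨y, ⟨b, ⟨hb, hy⟩ | ⟨hb, hy, hbo⟩, hb'⟩, hlink⟩
    · have hyb : ∀ i, y i = b := fun i => hy i (Finset.mem_univ i)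
      have hz : ∀ i, ∃ z ∈ R, lev (z o) < min (lev (t o)) (lev (s o)) ∧ b = z o ∧ x i = z i := by
        intro i
        rcases hlink i with h | ⟨h, -⟩ | ⟨h, -⟩
        · rwa [hyb] at h
        · rw [hyb] at h; rw [h] at hb; omega
        · rw [hyb] at h; rw [h] at hb; omega
      obtain ⟨z, hzR, hzo, hzb, -⟩ := hz o
      convert hzR using 1
      funext i
      obtain ⟨w, hwR, hwo, hwb, hwi⟩ := hz i
      rw [hwi]
      exact H.eq_of_eq hwR hzR hwo (hwb.symm.trans hzb)
    · have hb1 : b = one k := by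
        rcases hb' with h | h
        · rcases hb with rfl | rfl <;> omega
        · exact h
      have hxI : x = (Finset.univ.filter fun i => y i = one k).piecewise s t := by
        funext i
        rcases hlink i with ⟨z, -, h, e, -⟩ | ⟨h, e⟩ | ⟨h, e⟩
        · rcases hy i (Finset.mem_univ i) with h' | h' <;> rw [h'] at e <;> rw [← e] at h <;> omega
        · simp [Finset.piecewise, e, h]
        · simp [Finset.piecewise, e, h, h1.symm]
      rw [hxI, H.piecewise_mem_iff, Finset.card_filter]
      exact hbo.1 hb1

theorem ppd [Finite V] [Nontrivial V] (H : Critical R t s) : PPd R := by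
  cases nonempty_fintype V
  by_cases h3 : ∀ i h : V, ∃ g, g ≠ i ∧ g ≠ h
  · exact H.ppd_of_three h3
  · push Not at h3
    obtain ⟨i, h, hV⟩ := h3
    have hV' : ∀ g, g = i ∨ g = h := fun g => or_iff_not_imp_left.2 (hV g)
    refine H.ppd_of_pair (i := i) (h := h) ?_ hV'
    rintro rfl
    obtain ⟨g, hg⟩ := exists_ne i
    exact hg (hV g hg)

end Critical

theorem ppd_empty : PPd (∅ : Set (V → P n k)) :=
  ((pp1 fun _ : P n k => False).app (none : Option V)).exists_one.congr fun t => by simp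

/-- The coordinatewise collapse makes the image of R critical, hence definable; the separating
relation is the preimage of that image. -/
theorem exists_separating_of_update [Finite V] [Nontrivial V] [DecidableEq V]
    {R : Set (V → P n k)} (hR : OpClosed lev R) {t s : V → P n k} (ht : t ∉ R)
    (hs : ∀ i, Function.update t i (s i) ∈ R) : ∃ Q : Set (V → P n k), PPd Q ∧ R ⊆ Q ∧ t ∉ Q := by
  have hst : ∀ i, s i ≠ t i := by
    intro i e
    have := hs i
    rw [e, Function.update_eq_self] at this
    exact ht this
  obtain ⟨o⟩ : Nonempty V := inferInstance
  rcases k with _ | k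
  · exact (hst o ((eq_bot_of_zero _).trans (eq_bot_of_zero _).symm)).elim
  have hd : ∀ i, min (lev (t i)) (lev (s i)) + 1 ≤ k + 1 := by
    intro i
    have h2 := lev_le (t i)
    have h3 := lev_le (s i)
    have h4 : ¬(lev (t i) = k + 1 ∧ lev (s i) = k + 1) := fun e =>
      hst i ((lev_eq_iff.1 e.2).trans (lev_eq_iff.1 e.1).symm)
    omega
  let r : (V → P n (k + 1)) → V → P n (k + 1) :=
    fun x i => ret (min (lev (t i)) (lev (s i)) + 1) (x i)
  have hmin : ∀ i, min (lev (r t i)) (lev (r s i)) = min (lev (t i)) (lev (s i)) := by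
    intro i
    have := hd i
    have hb : lev (bot : P n (k + 1)) = k + 1 := lev_bot
    simp only [r, ret]
    grind
  have H : Critical (r '' R) (r t) (r s) := by
    refine ⟨?_, ?_, ?_, ?_⟩
    · rintro _ ⟨x, hx, rfl⟩ _ ⟨y, hy, rfl⟩ _ ⟨z, hz, rfl⟩
      exact ⟨_, hR x hx y hy z hz, funext fun i => (op_ret (hd i) _ _ _).symm⟩
    · rintro ⟨y, hy, e⟩
      exact ret_ne_of_notMem hR ht hs hy fun i => congrFun e i
    · intro i
      refine ⟨_, hs i, funext fun g => ?_⟩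
      by_cases e : g = i
      · subst e; simp [r]
      · simp [r, Function.update_of_ne e]
    · rintro _ ⟨x, hx, rfl⟩ i
      rw [hmin]
      simp only [r, ret]
      split_ifs with h
      · exact Or.inr rfl
      · exact Or.inl (by omega)
  refine ⟨{x | r x ∈ r '' R}, ?_, fun x hx => ⟨x, hx, rfl⟩, H.notMem⟩
  have h1 := H.ppd.comap (Sum.inr : V → V ⊕ V)
  have h2 := PPd.forall fun i => (pp2_ret (n := n) (hd i)).app (Sum.inl i : V ⊕ V) (Sum.inr i)
  refine (h1.and h2).exists.congr fun x => ?_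
  constructor
  · intro hx
    exact ⟨r x, hx, fun i => rfl⟩
  · rintro ⟨z, hz, e⟩
    obtain rfl : z = r x := funext e
    exact hz

/-- If no change of t at i leads into R, then t remains excluded after forgetting i, and the arity
drops. Otherwise every coordinate can be repaired separately, which is the critical situation once
the arity is at least two. -/
theorem exists_separating [Finite V] {R : Set (V → P n k)} (hR : OpClosed lev R)
    {t : V → P n k} (ht : t ∉ R) : ∃ Q : Set (V → P n k), PPd Q ∧ R ⊆ Q ∧ t ∉ Q := by
  classical
  induction hm : Nat.card V using Nat.strong_induction_on generalizing V with
  | _ m ih =>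
    by_cases hproj : ∀ i, ∃ s, Function.update t i s ∈ R
    · choose s hs using hproj
      rcases subsingleton_or_nontrivial V with hV | hV
      · rcases isEmpty_or_nonempty V with hV' | ⟨⟨i⟩⟩
        · refine ⟨∅, ppd_empty, fun x hx => ht ?_, id⟩
          rwa [Subsingleton.elim t x]
        · refine ⟨_, (pp1 fun a => Function.update t i a ∈ R).app i, fun x hx => ?_, ?_⟩
          · have : Function.update t i (x i) = x := by
              funext j
              rw [Subsingleton.elim j i, Function.update_self]
            rwa [Set.mem_ofPred_eq, this]
          · rwa [Set.mem_ofPred_eq, Function.update_eq_self]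
      · exact exists_separating_of_update hR ht hs
    · push Not at hproj
      obtain ⟨i, hi⟩ := hproj
      let π : (V → P n k) → {j // j ≠ i} → P n k := fun x j => x j
      have hcard : Nat.card {j // j ≠ i} < m := by
        rw [← hm]
        exact Finite.card_subtype_lt (x := i) (by simp)
      have hR' : OpClosed lev (π '' R) := by
        rintro _ ⟨x, hx, rfl⟩ _ ⟨y, hy, rfl⟩ _ ⟨z, hz, rfl⟩
        exact ⟨_, hR x hx y hy z hz, rfl⟩
      have ht' : π t ∉ π '' R := by
        rintro ⟨x, hx, e⟩
        refine hi (x i) ?_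
        convert hx using 1
        funext j
        by_cases hj : j = i
        · subst hj; simp
        · rw [Function.update_of_ne hj]
          exact (congrFun e ⟨j, hj⟩).symm
      obtain ⟨Q, hQ, hRQ, htQ⟩ := ih _ hcard hR' ht' rfl
      exact ⟨_, hQ.comap (Subtype.val : {j // j ≠ i} → V), fun x hx => hRQ ⟨x, hx, rfl⟩, htQ⟩

/-- Every invariant relation is primitive positive definable. -/
theorem OpClosed.ppd [Finite V] {R : Set (V → P n k)} (hR : OpClosed lev R) : PPd R := by
  choose Q hQ hRQ htQ using fun t : {t // t ∉ R} => exists_separating hR t.2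
  refine (PPd.forall hQ).congr fun t => ⟨fun ht i => hRQ i ht, fun h => ?_⟩
  by_contra ht
  exact htQ ⟨t, ht⟩ (h ⟨t, ht⟩)

end Separation

end ProjTree

theorem mainTheorem7 (n k : ℕ) (hn : 2 ≤ n) :
    ProjTree.Inv (ProjTree.projTree n k).basicOps =
        ProjTree.Inv (ProjTree.Pol (ProjTree.sig n k) (ProjTree.P n k)) ∧
      ProjTree.Inv (ProjTree.projTree n k).basicOps =
        ProjTree.PPDef (ProjTree.sig n k) (ProjTree.P n k) := by
  have : Fact (2 ≤ n) := ⟨hn⟩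
  have h1 : ProjTree.PPDef (ProjTree.sig n k) (ProjTree.P n k) ⊆
      ProjTree.Inv (ProjTree.Pol (ProjTree.sig n k) (ProjTree.P n k)) :=
    ProjTree.ppDef_subset_inv_pol
  have h2 : ProjTree.Inv (ProjTree.Pol (ProjTree.sig n k) (ProjTree.P n k)) ⊆
      ProjTree.Inv (ProjTree.projTree n k).basicOps :=
    fun R hR f hf => hR f (ProjTree.basicOps_subset_pol hf)
  have h3 : ProjTree.Inv (ProjTree.projTree n k).basicOps ⊆
      ProjTree.PPDef (ProjTree.sig n k) (ProjTree.P n k) :=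
    fun R hR => ((ProjTree.mem_inv_basicOps_iff R).1 hR).ppd.mem_ppDef
  exact ⟨(h3.trans h1).antisymm h2, h3.antisymm (h1.trans h2)⟩
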